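/- For each sample size $n$ consider the linear IV model $Y_i=X_i\beta+e_i$, $X_i=\Pi_i+V_i$, $i\in[n]=\{1,\dots,n\}$, with a fixed $n\times K$ instrument matrix $Z$ and $P=Z(Z^\top Z)^{-1}Z^\top$; all quantities, including $\beta$ and $K$, may depend on $n$, and $\beta=\beta_n$ is bounded. Suppose that (i) the pairs $(e_i,V_i)_{i\in[n]}$ are independent over $i$ with $\mathbb E e_i=\mathbb E V_i=0$; $P$ is a projection matrix of rank $K$; $K\to\infty$; and $P_{ii}\le\delta<1$ for a constant $\delta$; (ii) $\max_{i}|\Pi_i|\le C$, $\Pi^\top\Pi/K\to0$, and $\max_i\mathbb E e_i^6+\max_i\mathbb E V_i^6\le C$, for a constant $C<\infty$ independent of $n$. Let $\sigma_i^2=\mathbb E e_i^2$, $\eta_i^2=\mathbb E V_i^2$, $\gamma_i=\mathbb E e_iV_i$, $\omega_i=\sum_{j\ne i}P_{ij}\Pi_j$, and suppose the following limits exist (sums over $i\in[n]$ and $j\neq i$): $$\Phi_1=\lim\tfrac2K\sum_{i}\sum_{j\ne i}P_{ij}^2\sigma_i^2\sigma_j^2,\quad \Phi_{12}=\lim\tfrac1K\sum_i\sum_{j\ne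 i}P_{ij}^2(\gamma_j\sigma_i^2+\gamma_i\sigma_j^2),\quad \Phi_{13}=\lim\tfrac2K\sum_i\sum_{j\ne i}P_{ij}^2\gamma_i\gamma_j,$$ $$\Psi=\lim\Big[\tfrac1K\sum_i\sum_{j\ne i}P_{ij}^2(\eta_i^2\sigma_j^2+\gamma_i\gamma_j)+\tfrac1K\sum_i\omega_i^2\sigma_i^2\Big],\quad \tau=\lim\Big[\tfrac2K\sum_i\sum_{j\ne i}P_{ij}^2\eta_i^2\gamma_j+\tfrac2K\sum_i\omega_i^2\gamma_i\Big],$$ $$\Upsilon=\lim\Big[\tfrac2K\sum_i\sum_{j\ne i}P_{ij}^2\eta_i^2\eta_j^2+\tfrac4K\sum_i\omega_i^2\eta_i^2\Big].$$ For $\beta_0\in\mathbb R$ put $\Delta=\beta-\beta_0$ and $$\Phi_1(\beta_0)=\Delta^4\Upsilon+4\Delta^3\tau+\Delta^2(4\Psi+2\Phi_{13})+4\Delta\Phi_{12}+\Phi_1,\quad \Phi_{12}(\beta_0)=\Delta^3\Upsilon+3\Delta^2\tau+\Delta(2\Psi+\Phi_{13})+\Phi_{12},$$ $$\Phi_{13}(\beta_0)=\Delta^2\Upsilon+2\Delta\tau+\Phi_{13},\quad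 \Psi(\beta_0)=\Delta^2\Upsilon+2\Delta\tau+\Psi,\quad \tau(\beta_0)=\Delta\Upsilon+\tau,\quad \rho(\beta_0)=\frac{\Phi_{12}(\beta_0)}{\sqrt{\Phi_1(\beta_0)\Psi(\beta_0)}}.$$ With $e_i(\beta_0)=Y_i-X_i\beta_0$ define the estimators $$\widehat\Phi_1(\beta_0)=\tfrac2K\sum_i\sum_{j\ne i}P_{ij}^2e_i^2(\beta_0)e_j^2(\beta_0),\quad \widehat\Phi_{12}(\beta_0)=\tfrac1K\sum_i\sum_{j\ne i}P_{ij}^2\big(X_je_j(\beta_0)e_i^2(\beta_0)+X_ie_i(\beta_0)e_j^2(\beta_0)\big),$$ $$\widehat\Phi_{13}(\beta_0)=\tfrac2K\sum_i\sum_{j\ne i}P_{ij}^2X_ie_i(\beta_0)X_je_j(\beta_0),\quad \widehat\Upsilon=\tfrac2K\sum_i\sum_{j\ne i}P_{ij}^2X_i^2X_j^2,$$ $$\widehat\Psi(\beta_0)=\tfrac1K\sum_i\Big(\sum_{j\ne i}P_{ij}X_j\Big)^2e_i^2(\beta_0)+\tfrac1K\sum_i\sum_{j\ne i}P_{ij}^2X_ie_i(\beta_0)X_je_j(\beta_0),$$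 $$\widehat\tau(\beta_0)=\tfrac1K\sum_i\Big(\sum_{j\ne i}P_{ij}X_j\Big)^2X_ie_i(\beta_0)+\tfrac1K\sum_i\sum_{j\ne i}P_{ij}^2X_i^2X_je_j(\beta_0),$$ and $\widehat\rho(\beta_0)=\widehat\Phi_{12}(\beta_0)/\sqrt{\widehat\Phi_1(\beta_0)\widehat\Psi(\beta_0)}$. Then: (a) for every $\beta_0\in\mathbb R$, $(\widehat\Phi_1(\beta_0),\widehat\Phi_{12}(\beta_0),\widehat\Phi_{13}(\beta_0),\widehat\Psi(\beta_0),\widehat\tau(\beta_0),\widehat\Upsilon)-(\Phi_1(\beta_0),\Phi_{12}(\beta_0),\Phi_{13}(\beta_0),\Psi(\beta_0),\tau(\beta_0),\Upsilon)=o_p(1)$ in Euclidean norm; (b) for every $\beta_0\in\mathbb R$ at which $\Phi_1(\beta_0)$ and $\Psi(\beta_0)$ are, for all large $n$, bounded below by a positive constant, the same holds for the seven-dimensional vectors $\widehat\gamma(\beta_0)$ and $\gamma(\beta_0)$ obtained by appending $\widehat\rho(\beta_0)$ and $\rho(\beta_0)$; (c) consequently, for every compact $\mathcal B\subset\mathbb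 R$ such that $\inf_{\beta_0\in\mathcal B}\Phi_1(\beta_0)>0$, $\inf_{\beta_0\in\mathcal B}\Psi(\beta_0)>0$ (uniformly in $n$) and $\Upsilon>0$, these positivity requirements hold together with $\|\widehat\gamma(\beta_0)-\gamma(\beta_0)\|_2=o_p(1)$ for every $\beta_0\in\mathcal B$; (d) if the matrix $\begin{pmatrix}\Phi_1&\Phi_{12}&\Phi_{13}\\ \Phi_{12}&\Psi&\tau\\ \Phi_{13}&\tau&\Upsilon\end{pmatrix}$ is positive definite, then for every compact $\mathcal B\subset\mathbb R$ the three positivity requirements of (c) hold (uniformly in $n$), and $\|\widehat\gamma(\beta_0)-\gamma(\beta_0)\|_2=o_p(1)$ for every $\beta_0\in\mathcal B$. -/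

import Mathlib

open MeasureTheory ProbabilityTheory Filter Topology

noncomputable section

/-- The six variance components `(Φ₁, Φ₁₂, Φ₁₃, Ψ, τ, Υ)`. -/
structure VarComp where
  Phi1 : ℝ
  Phi12 : ℝ
  Phi13 : ℝ
  Psi : ℝ
  tau : ℝ
  Upsilon : ℝ

namespace VarComp

/-- The covariance matrix of the joint limit law, assembled from the six components. -/
def cov (v : VarComp) : Matrix (Fin 3) (Fin 3) ℝ :=
  !![v.Phi1, v.Phi12, v.Phi13;
     v.Phi12, v.Psi, v.tau;
     v.Phi13, v.tau, v.Upsilon]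

/-- The components at `β₀`, as functions of `Δ = β - β₀` and of the components at `β`. -/
def shift (v : VarComp) (D : ℝ) : VarComp where
  Phi1 := D ^ 4 * v.Upsilon + 4 * D ^ 3 * v.tau + D ^ 2 * (4 * v.Psi + 2 * v.Phi13)
    + 4 * D * v.Phi12 + v.Phi1
  Phi12 := D ^ 3 * v.Upsilon + 3 * D ^ 2 * v.tau + D * (2 * v.Psi + v.Phi13) + v.Phi12
  Phi13 := D ^ 2 * v.Upsilon + 2 * D * v.tau + v.Phi13
  Psi := D ^ 2 * v.Upsilon + 2 * D * v.tau + v.Psi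
  tau := D * v.Upsilon + v.tau
  Upsilon := v.Upsilon

/-- `ρ = Φ₁₂ / √(Φ₁ Ψ)`. -/
def rho (v : VarComp) : ℝ := v.Phi12 / Real.sqrt (v.Phi1 * v.Psi)

/-- The vector of the six components. -/
def vec (v : VarComp) : EuclideanSpace ℝ (Fin 6) :=
  !₂[v.Phi1, v.Phi12, v.Phi13, v.Psi, v.tau, v.Upsilon]

/-- The vector `γ = (Φ₁, Φ₁₂, Φ₁₃, Ψ, τ, Υ, ρ)`. -/
def gamma (v : VarComp) : EuclideanSpace ℝ (Fin 7) :=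
  !₂[v.Phi1, v.Phi12, v.Phi13, v.Psi, v.tau, v.Upsilon, v.rho]

end VarComp

/-- One row of the drifting array: the linear IV regression
`Y i = X i * β + e i`, `X i = Π i + V i` with `n` observations and a fixed `n × k` instrument
matrix `Z`. -/
structure IVModel (n k : ℕ) (Ω : Type*) where
  Z : Matrix (Fin n) (Fin k) ℝ
  Pi : Fin n → ℝ
  beta : ℝ
  e : Fin n → Ω → ℝ
  V : Fin n → Ω → ℝ

namespace IVModel

variable {n k : ℕ} {Ω : Type*}

/-- The endogenous variable. -/
def X (M : IVModel n k Ω) (i : Fin n) (ω : Ω) : ℝ := M.Pi i + M.V i ω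

/-- The outcome. -/
def Y (M : IVModel n k Ω) (i : Fin n) (ω : Ω) : ℝ := M.X i ω * M.beta + M.e i ω

/-- The residual `e_i(β₀) = Y_i - X_i β₀`. -/
def res (M : IVModel n k Ω) (b : ℝ) (i : Fin n) (ω : Ω) : ℝ := M.Y i ω - M.X i ω * b

/-- `P = Z (ZᵀZ)⁻¹ Zᵀ`. -/
def P (M : IVModel n k Ω) : Matrix (Fin n) (Fin n) ℝ :=
  M.Z * (M.Z.transpose * M.Z)⁻¹ * M.Z.transpose

/-- `ω_i = ∑_{j ≠ i} P_ij Π_j`. -/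
def om (M : IVModel n k Ω) (i : Fin n) : ℝ := ∑ j ∈ Finset.univ.erase i, M.P i j * M.Pi j

/-- `∑_i ∑_{j ≠ i} P_ij² a(i, j)`. -/
def offSum (M : IVModel n k Ω) (a : Fin n → Fin n → ℝ) : ℝ :=
  ∑ i, ∑ j ∈ Finset.univ.erase i, M.P i j ^ 2 * a i j

/-- The standard (leave-one-out) variance estimators at `β₀ = b`. -/
def est (M : IVModel n k Ω) (b : ℝ) (ω : Ω) : VarComp where
  Phi1 := 2 / (k : ℝ) * M.offSum fun i j => M.res b i ω ^ 2 * M.res b j ω ^ 2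
  Phi12 := 1 / (k : ℝ) * M.offSum fun i j =>
    M.X j ω * M.res b j ω * M.res b i ω ^ 2 + M.X i ω * M.res b i ω * M.res b j ω ^ 2
  Phi13 := 2 / (k : ℝ) * M.offSum fun i j =>
    M.X i ω * M.res b i ω * (M.X j ω * M.res b j ω)
  Psi := 1 / (k : ℝ) * ∑ i, (∑ j ∈ Finset.univ.erase i, M.P i j * M.X j ω) ^ 2 * M.res b i ω ^ 2
    + 1 / (k : ℝ) * M.offSum fun i j => M.X i ω * M.res b i ω * (M.X j ω * M.res b j ω)
  tau := 1 / (k : ℝ) * ∑ i, (∑ j ∈ Finset.univ.erase i, M.P i j * M.X j ω) ^ 2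
      * (M.X i ω * M.res b i ω)
    + 1 / (k : ℝ) * M.offSum fun i j => M.X i ω ^ 2 * (M.X j ω * M.res b j ω)
  Upsilon := 2 / (k : ℝ) * M.offSum fun i j => M.X i ω ^ 2 * M.X j ω ^ 2

variable [MeasurableSpace Ω]

/-- `σ_i² = E e_i²`. -/
def sigmaSq (M : IVModel n k Ω) (μ : Measure Ω) (i : Fin n) : ℝ := ∫ ω, M.e i ω ^ 2 ∂μ

/-- `η_i² = E V_i²`. -/
def etaSq (M : IVModel n k Ω) (μ : Measure Ω) (i : Fin n) : ℝ := ∫ ω, M.V i ω ^ 2 ∂μ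

/-- `γ_i = E e_i V_i`. -/
def gam (M : IVModel n k Ω) (μ : Measure Ω) (i : Fin n) : ℝ := ∫ ω, M.e i ω * M.V i ω ∂μ

/-- The finite-sample variance components, whose limits are `(Φ₁, Φ₁₂, Φ₁₃, Ψ, τ, Υ)`. -/
def pop (M : IVModel n k Ω) (μ : Measure Ω) : VarComp where
  Phi1 := 2 / (k : ℝ) * M.offSum fun i j => M.sigmaSq μ i * M.sigmaSq μ j
  Phi12 := 1 / (k : ℝ) * M.offSum fun i j =>
    M.gam μ j * M.sigmaSq μ i + M.gam μ i * M.sigmaSq μ j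
  Phi13 := 2 / (k : ℝ) * M.offSum fun i j => M.gam μ i * M.gam μ j
  Psi := (1 / (k : ℝ) * M.offSum fun i j => M.etaSq μ i * M.sigmaSq μ j + M.gam μ i * M.gam μ j)
    + 1 / (k : ℝ) * ∑ i, M.om i ^ 2 * M.sigmaSq μ i
  tau := (2 / (k : ℝ) * M.offSum fun i j => M.etaSq μ i * M.gam μ j)
    + 2 / (k : ℝ) * ∑ i, M.om i ^ 2 * M.gam μ i
  Upsilon := (2 / (k : ℝ) * M.offSum fun i j => M.etaSq μ i * M.etaSq μ j)
    + 4 / (k : ℝ) * ∑ i, M.om i ^ 2 * M.etaSq μ i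

end IVModel

section Array

variable {K : ℕ → ℕ} {Ω : ℕ → Type*} [∀ n, MeasurableSpace (Ω n)]

/-- `T n = o_P(1)`, where each `T n` lives on its own probability space. -/
def IsLittleOProb (μ : ∀ n, Measure (Ω n)) {E : Type*} [NormedAddCommGroup E]
    (T : ∀ n, Ω n → E) : Prop :=
  ∀ ε : ℝ, 0 < ε → Tendsto (fun n => μ n {ω | ε ≤ ‖T n ω‖}) atTop (𝓝 0)

/-- Independent mean-zero error pairs; `P` a projection of rank `K → ∞` whose diagonal is
bounded by some `δ < 1`. -/
structure ProjectionDesign (μ : ∀ n, Measure (Ω n)) (M : ∀ n, IVModel n (K n) (Ω n)) : Prop where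
  meas_e : ∀ n i, Measurable ((M n).e i)
  meas_V : ∀ n i, Measurable ((M n).V i)
  indep : ∀ n, iIndepFun (fun i ω => ((M n).e i ω, (M n).V i ω)) (μ n)
  mean_e : ∀ n i, Integrable ((M n).e i) (μ n) ∧ ∫ ω, (M n).e i ω ∂(μ n) = 0
  mean_V : ∀ n i, Integrable ((M n).V i) (μ n) ∧ ∫ ω, (M n).V i ω ∂(μ n) = 0
  rank_P : ∀ n, (M n).P.rank = K n
  K_tendsto : Tendsto K atTop atTop
  diag_P : ∃ δ : ℝ, δ < 1 ∧ ∀ n i, (M n).P i i ≤ δ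

/-- Bounded `Π_i`, `ΠᵀΠ / K → 0`, and sixth moments of the errors bounded uniformly in `i`, `n`. -/
structure MomentConditions (μ : ∀ n, Measure (Ω n)) (M : ∀ n, IVModel n (K n) (Ω n)) : Prop where
  bdd_Pi : ∃ C : ℝ, ∀ n i, |(M n).Pi i| ≤ C
  Pi_small : Tendsto (fun n => (∑ i, (M n).Pi i ^ 2) / (K n : ℝ)) atTop (𝓝 0)
  sixth_e : ∃ C : ℝ, ∀ n i, Integrable (fun ω => (M n).e i ω ^ 6) (μ n) ∧
    ∫ ω, (M n).e i ω ^ 6 ∂(μ n) ≤ C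
  sixth_V : ∃ C : ℝ, ∀ n i, Integrable (fun ω => (M n).V i ω ^ 6) (μ n) ∧
    ∫ ω, (M n).V i ω ^ 6 ∂(μ n) ≤ C

/-- `L` collects the limits of the finite-sample variance components. -/
structure IsVarLimit (μ : ∀ n, Measure (Ω n)) (M : ∀ n, IVModel n (K n) (Ω n))
    (L : VarComp) : Prop where
  Phi1 : Tendsto (fun n => ((M n).pop (μ n)).Phi1) atTop (𝓝 L.Phi1)
  Phi12 : Tendsto (fun n => ((M n).pop (μ n)).Phi12) atTop (𝓝 L.Phi12)
  Phi13 : Tendsto (fun n => ((M n).pop (μ n)).Phi13) atTop (𝓝 L.Phi13)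
  Psi : Tendsto (fun n => ((M n).pop (μ n)).Psi) atTop (𝓝 L.Psi)
  tau : Tendsto (fun n => ((M n).pop (μ n)).tau) atTop (𝓝 L.tau)
  Upsilon : Tendsto (fun n => ((M n).pop (μ n)).Upsilon) atTop (𝓝 L.Upsilon)

/-- The components `(Φ₁(β₀), …, Υ)` at `β₀ = b` in the `n`-th model, with `Δ = β - b`. -/
def compAt (M : ∀ n, IVModel n (K n) (Ω n)) (L : VarComp) (b : ℝ) (n : ℕ) : VarComp :=
  L.shift ((M n).beta - b)

/-- The positivity requirements: `inf_{β₀ ∈ B} Φ₁(β₀) > 0`, `inf_{β₀ ∈ B} Ψ(β₀) > 0` and `Υ > 0`.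
As the true `β` may drift with `n`, the infima are bounded below uniformly in `n`. -/
structure PositiveVariances (M : ∀ n, IVModel n (K n) (Ω n)) (L : VarComp) (B : Set ℝ) :
    Prop where
  Phi1_pos : ∃ c : ℝ, 0 < c ∧ ∀ n, ∀ b ∈ B, c ≤ (compAt M L b n).Phi1
  Psi_pos : ∃ c : ℝ, 0 < c ∧ ∀ n, ∀ b ∈ B, c ≤ (compAt M L b n).Psi
  Upsilon_pos : 0 < L.Upsilon

/-- Positivity of the variances over the parameter space `B`, and consistency of
`γ̂(β₀)`, including the plug-in `ρ̂(β₀)`, at every `β₀ ∈ B`. -/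
structure ConsistentVarianceEstimation (μ : ∀ n, Measure (Ω n))
    (M : ∀ n, IVModel n (K n) (Ω n)) (L : VarComp) (B : Set ℝ) : Prop where
  pos : PositiveVariances M L B
  consistent : ∀ b ∈ B, IsLittleOProb μ fun n ω =>
    ((M n).est b ω).gamma - (compAt M L b n).gamma

end Array

end

/-! Put Δ = β - β₀. Since e_i(β₀) = e_i + Δ X_i, every estimator is a polynomial in Δ whose
coefficients combine nine statistics free of β₀: the quadratic forms K⁻¹ ∑ P_ij² x_i y_j with x, y
among e², Xe, X², and the jackknife forms K⁻¹ ∑ (∑_{j≠i} P_ij X_j)² c_i with c among the same three.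
As β_n is bounded, it suffices to find the nine limits in probability (`formsConsistent`) and to
match coefficients with `VarComp.shift`.

Expanding around means turns each statistic into a deterministic part plus multilinear forms in
independent centered variables (`IsSymmIdem.bilinear_decomp`, `IsSymmIdem.jackknife_decomp`). Terms
carried by different index sets are orthogonal, so the second moment of such a form is at most a
constant times the sum of its squared weights (`secondMomentLe_multilinear`). Because `P` is an
orthogonal projection of trace K, these sums are O(K), or o(K²) when the weights contain ω; after
division by K², Chebyshev's inequality finishes.

In the deterministic part Π enters only through quantities of order ΠᵀΠ/K → 0, so X_i² counts as
V_i². A jackknife form keeps only the diagonal j = k of its squared sum, that is, the quadratic form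
of c and V².

The ratio ρ is continuous near the compact set in which the moving centers lie
(`IsLittleOProb.comp_of_isCompact`). Under positive definiteness, Φ₁(β₀) and Ψ(β₀) are values of the
quadratic form of the covariance matrix at (1, 2Δ, Δ²) and (0, 1, Δ), which never vanish, while Δ
stays in a compact interval. -/

noncomputable section

/-! ### Second moments of multilinear forms in independent variables -/

section SecondMoment

variable {Ω : Type*} [MeasurableSpace Ω] {μ : Measure Ω}

/-- `X` is square integrable, with second moment at most `c`. -/
def SecondMomentLe (μ : Measure Ω) (X : Ω → ℝ) (c : ℝ) : Prop :=
  Integrable (fun ω => X ω ^ 2) μ ∧ ∫ ω, X ω ^ 2 ∂μ ≤ c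

/-- In the expanded square only pairs with equal keys survive. On those, |E f_s f_t| ≤ B and |w_s
w_t| ≤ (w_s² + w_t²)/2, and each index meets at most `N` partners. -/
theorem secondMomentLe_sum_of_orthogonal {I κ : Type*} [DecidableEq κ] (T : Finset I)
    (f : I → Ω → ℝ) (key : I → κ) (w : I → ℝ) {B : ℝ} {N : ℕ}
    (hf : ∀ s ∈ T, MemLp (f s) 2 μ) (hB : ∀ s ∈ T, ∫ ω, f s ω ^ 2 ∂μ ≤ B)
    (horth : ∀ s ∈ T, ∀ t ∈ T, key s ≠ key t → ∫ ω, f s ω * f t ω ∂μ = 0)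
    (hN : ∀ s ∈ T, (T.filter fun t => key t = key s).card ≤ N) :
    SecondMomentLe μ (fun ω => ∑ s ∈ T, w s * f s ω) (N * B * ∑ s ∈ T, w s ^ 2) := by
  refine ⟨(memLp_finsetSum T fun s hs => (hf s hs).const_mul (w s)).integrable_sq, ?_⟩
  have hint : ∀ s ∈ T, ∀ t ∈ T, Integrable (fun ω => f s ω * f t ω) μ :=
    fun s hs t ht => (hf s hs).integrable_mul (hf t ht)
  have hsq : ∀ s ∈ T, Integrable (fun ω => f s ω ^ 2) μ := fun s hs => (hf s hs).integrable_sq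
  have hprod : ∀ s ∈ T, ∀ t ∈ T, w s * w t * ∫ ω, f s ω * f t ω ∂μ ≤
      if key t = key s then (w s ^ 2 + w t ^ 2) / 2 * B else 0 := by
    intro s hs t ht
    split_ifs with h
    · have h1 : w s * w t * ∫ ω, f s ω * f t ω ∂μ ≤ |w s * w t| * |∫ ω, f s ω * f t ω ∂μ| := by
        rw [← abs_mul]; exact le_abs_self _
      have h2 : |∫ ω, f s ω * f t ω ∂μ| ≤ B := by
        calc |∫ ω, f s ω * f t ω ∂μ| ≤ ∫ ω, |f s ω * f t ω| ∂μ := abs_integral_le_integral_abs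
          _ ≤ ∫ ω, (f s ω ^ 2 / 2 + f t ω ^ 2 / 2) ∂μ := by
              refine integral_mono (hint s hs t ht).abs
                (((hsq s hs).div_const 2).add ((hsq t ht).div_const 2)) fun ω => ?_
              simp only [abs_mul]
              nlinarith [sq_nonneg (|f s ω| - |f t ω|), sq_abs (f s ω), sq_abs (f t ω)]
          _ ≤ B := by
              rw [integral_add ((hsq s hs).div_const 2) ((hsq t ht).div_const 2),
                integral_div, integral_div]
              linarith [hB s hs, hB t ht]
      have hB0 : 0 ≤ B := (abs_nonneg _).trans h2
      have h3 : |w s * w t| ≤ (w s ^ 2 + w t ^ 2) / 2 := by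
        rw [abs_mul]
        nlinarith [sq_nonneg (|w s| - |w t|), sq_abs (w s), sq_abs (w t)]
      exact h1.trans (mul_le_mul h3 h2 (abs_nonneg _) (by positivity))
    · rw [horth s hs t ht (Ne.symm h), mul_zero]
  have hexp : ∫ ω, (∑ s ∈ T, w s * f s ω) ^ 2 ∂μ
      = ∑ s ∈ T, ∑ t ∈ T, w s * w t * ∫ ω, f s ω * f t ω ∂μ := by
    have : ∀ ω, (∑ s ∈ T, w s * f s ω) ^ 2
        = ∑ s ∈ T, ∑ t ∈ T, w s * w t * (f s ω * f t ω) := by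
      intro ω
      rw [sq, Finset.sum_mul_sum]
      exact Finset.sum_congr rfl fun s _ => Finset.sum_congr rfl fun t _ => by ring
    simp_rw [this]
    rw [integral_finsetSum _ fun s hs => integrable_finsetSum _ fun t ht =>
      (hint s hs t ht).const_mul _]
    refine Finset.sum_congr rfl fun s hs => ?_
    rw [integral_finsetSum _ fun t ht => (hint s hs t ht).const_mul _]
    exact Finset.sum_congr rfl fun t _ => integral_const_mul _ _
  -- The condition on keys is symmetric in s and t, so both halves have the same sum and all the
  -- weight can be put on s.
  have hsym : ∑ s ∈ T, ∑ t ∈ T, (if key t = key s then (w s ^ 2 + w t ^ 2) / 2 * B else 0)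
      = ∑ s ∈ T, ∑ t ∈ T, (if key t = key s then w s ^ 2 * B else 0) := by
    have e1 : ∑ s ∈ T, ∑ t ∈ T, (if key t = key s then w s ^ 2 * B / 2 else 0)
        = ∑ s ∈ T, ∑ t ∈ T, (if key t = key s then w t ^ 2 * B / 2 else 0) := by
      rw [Finset.sum_comm]
      exact Finset.sum_congr rfl fun s _ => Finset.sum_congr rfl fun t _ => by simp only [eq_comm]
    calc _ = ∑ s ∈ T, ∑ t ∈ T, (if key t = key s then w s ^ 2 * B / 2 else 0)
          + ∑ s ∈ T, ∑ t ∈ T, (if key t = key s then w t ^ 2 * B / 2 else 0) := by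
            simp only [← Finset.sum_add_distrib]
            refine Finset.sum_congr rfl fun s _ => Finset.sum_congr rfl fun t _ => ?_
            split_ifs <;> ring
      _ = _ := by
            rw [← e1]
            simp only [← Finset.sum_add_distrib]
            refine Finset.sum_congr rfl fun s _ => Finset.sum_congr rfl fun t _ => ?_
            split_ifs <;> ring
  rw [hexp]
  refine (Finset.sum_le_sum fun s hs => Finset.sum_le_sum fun t ht => hprod s hs t ht).trans ?_
  rw [hsym, Finset.mul_sum]
  refine Finset.sum_le_sum fun s hs => ?_
  have hB0 : 0 ≤ B := (integral_nonneg fun ω => sq_nonneg (f s ω)).trans (hB s hs)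
  rw [← Finset.sum_filter, Finset.sum_const, nsmul_eq_mul]
  have := hN s hs
  calc _ ≤ (N : ℝ) * (w s ^ 2 * B) := by gcongr
    _ = _ := by ring

variable {ι S : Type*} [Fintype ι] [MeasurableSpace S] {ζ : ι → Ω → S}

/-- Independence makes the joint law a product measure, for which a product of integrable
one-variable functions is integrable. -/
theorem iIndepFun.integrable_prod_comp (hind : iIndepFun ζ μ) (hζ : ∀ i, Measurable (ζ i))
    {g : ι → S → ℝ} (hg : ∀ i, Measurable (g i))
    (hint : ∀ i, Integrable (fun ω => g i (ζ i ω)) μ) :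
    Integrable (fun ω => ∏ i, g i (ζ i ω)) μ := by
  have := hind.isProbabilityMeasure
  have hmap := hind.map_fun_eq_pi_map fun i => (hζ i).aemeasurable
  have hm : Measurable fun ω i => ζ i ω := measurable_pi_iff.2 hζ
  have : ∀ i, IsProbabilityMeasure (μ.map (ζ i)) :=
    fun i => Measure.isProbabilityMeasure_map (hζ i).aemeasurable
  have h : Integrable (fun x : ι → S => ∏ i, g i (x i)) (Measure.pi fun i => μ.map (ζ i)) :=
    Integrable.fintype_prod fun i =>
      (integrable_map_measure (hg i).aestronglyMeasurable (hζ i).aemeasurable).2 (hint i)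
  rw [← hmap] at h
  exact h.comp_measurable hm

/-- The key of a monomial is the set of variables that occur in it; the factors elsewhere are 1. If
two keys differ, some variable occurs in exactly one of the monomials, and its centered factor makes
the expected product vanish. Monomials with the same key, such as permuted index tuples, need not be
orthogonal; `N` counts them. -/
theorem secondMomentLe_multilinear [DecidableEq ι] (hind : iIndepFun ζ μ)
    (hζ : ∀ i, Measurable (ζ i)) {I : Type*} (T : Finset I) (key : I → Finset ι)
    (h : I → ι → S → ℝ) (w : I → ℝ) {B : ℝ} {m N : ℕ} (hB1 : 1 ≤ B)
    (hmeas : ∀ s ∈ T, ∀ i, Measurable (h s i))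
    (hLp : ∀ s ∈ T, ∀ i, MemLp (fun ω => h s i (ζ i ω)) 2 μ)
    (hsq : ∀ s ∈ T, ∀ i ∈ key s, ∫ ω, h s i (ζ i ω) ^ 2 ∂μ ≤ B)
    (hmean : ∀ s ∈ T, ∀ i ∈ key s, ∫ ω, h s i (ζ i ω) ∂μ = 0)
    (hone : ∀ s ∈ T, ∀ i ∉ key s, ∀ x, h s i x = 1)
    (hcard : ∀ s ∈ T, (key s).card ≤ m)
    (hN : ∀ s ∈ T, (T.filter fun t => key t = key s).card ≤ N) :
    SecondMomentLe μ (fun ω => ∑ s ∈ T, w s * ∏ i, h s i (ζ i ω))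
      (N * B ^ m * ∑ s ∈ T, w s ^ 2) := by
  have hprob := hind.isProbabilityMeasure
  refine secondMomentLe_sum_of_orthogonal T (fun s ω => ∏ i, h s i (ζ i ω)) key w ?_ ?_ ?_ hN
  · intro s hs
    rw [memLp_two_iff_integrable_sq]
    · simp only [← Finset.prod_pow]
      exact iIndepFun.integrable_prod_comp (g := fun i x => h s i x ^ 2) hind hζ
        (fun i => (hmeas s hs i).pow_const 2) fun i => (hLp s hs i).integrable_sq
    · exact (Finset.measurable_fun_prod _ fun i _ =>
        (hmeas s hs i).comp (hζ i)).aestronglyMeasurable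
  · intro s hs
    simp only [← Finset.prod_pow]
    rw [hind.integral_fun_prod_comp (f := fun i x => h s i x ^ 2)
      (fun i => (hζ i).aemeasurable) fun i => ((hmeas s hs i).pow_const 2).aestronglyMeasurable]
    calc ∏ i, ∫ ω, h s i (ζ i ω) ^ 2 ∂μ ≤ ∏ i, (if i ∈ key s then B else 1) := by
          refine Finset.prod_le_prod (fun i _ => integral_nonneg fun ω => sq_nonneg _) fun i _ => ?_
          split_ifs with hi
          · exact hsq s hs i hi
          · simp [hone s hs i hi]
      _ = B ^ (key s).card := by simp
      _ ≤ B ^ m := pow_le_pow_right₀ hB1 (hcard s hs)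
  · intro s hs t ht hst
    simp only [← Finset.prod_mul_distrib]
    rw [hind.integral_fun_prod_comp (f := fun i x => h s i x * h t i x)
      (fun i => (hζ i).aemeasurable)
      fun i => ((hmeas s hs i).mul (hmeas t ht i)).aestronglyMeasurable]
    obtain ⟨i, hi⟩ : ∃ i, ¬ (i ∈ key s ↔ i ∈ key t) := by
      by_contra hcon
      push Not at hcon
      exact hst (Finset.ext hcon)
    refine Finset.prod_eq_zero (Finset.mem_univ i) ?_
    by_cases his : i ∈ key s
    · have hit : i ∉ key t := fun hit => hi ⟨fun _ => hit, fun _ => his⟩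
      simp [hone t ht i hit, hmean s hs i his]
    · have hit : i ∈ key t := by_contra fun hit => hi ⟨fun q => absurd q his, fun q => absurd q hit⟩
      simp [hone s hs i his, hmean t ht i hit]

/-- Functions `a i` of the `i`-th variable with second moments bounded by `B`. -/
structure SqBounded (μ : Measure Ω) (ζ : ι → Ω → S) (B : ℝ) (a : ι → S → ℝ) : Prop where
  meas : ∀ i, Measurable (a i)
  memLp : ∀ i, MemLp (fun ω => a i (ζ i ω)) 2 μ
  sq_le : ∀ i, ∫ ω, a i (ζ i ω) ^ 2 ∂μ ≤ B

/-- Centered functions `a i` of the `i`-th variable with second moments bounded by `B`. -/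
structure CenteredSqBounded (μ : Measure Ω) (ζ : ι → Ω → S) (B : ℝ) (a : ι → S → ℝ) : Prop
    extends SqBounded μ ζ B a where
  mean : ∀ i, ∫ ω, a i (ζ i ω) ∂μ = 0

/-- The mean of `a i`. -/
def meanOf (μ : Measure Ω) (ζ : ι → Ω → S) (a : ι → S → ℝ) (i : ι) : ℝ := ∫ ω, a i (ζ i ω) ∂μ

/-- `a i` minus its mean. -/
def centered (μ : Measure Ω) (ζ : ι → Ω → S) (a : ι → S → ℝ) (i : ι) (x : S) : ℝ :=
  a i x - meanOf μ ζ a i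

variable {B : ℝ} {a b c : ι → S → ℝ}

omit [Fintype ι] in
theorem SqBounded.meanOf_sq_le [IsProbabilityMeasure μ] (ha : SqBounded μ ζ B a) (i : ι) :
    meanOf μ ζ a i ^ 2 ≤ B := by
  have h1 := variance_nonneg (fun ω => a i (ζ i ω)) μ
  rw [variance_eq_sub (ha.memLp i)] at h1
  have := ha.sq_le i
  simp only [Pi.pow_apply] at h1
  unfold meanOf
  linarith

omit [Fintype ι] in
theorem SqBounded.center [IsProbabilityMeasure μ] (ha : SqBounded μ ζ B a) :
    CenteredSqBounded μ ζ B (centered μ ζ a) where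
  meas i := (ha.meas i).sub_const _
  memLp i := (ha.memLp i).sub (memLp_const _)
  mean i := by
    have := (ha.memLp i).integrable one_le_two
    simp only [centered]
    rw [integral_sub this (integrable_const _)]
    simp [meanOf]
  sq_le i := by
    have h0 := (ha.memLp i).integrable one_le_two
    have h1 := variance_eq_sub (ha.memLp i)
    rw [variance_eq_integral h0.aemeasurable] at h1
    simp only [centered, meanOf]
    simp only [Pi.pow_apply] at h1
    rw [h1]
    linarith [ha.sq_le i, sq_nonneg (∫ ω, a i (ζ i ω) ∂μ)]

/-! ### Linear, bilinear and trilinear forms over distinct indices. -/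

section Forms

variable [DecidableEq ι] (hind : iIndepFun ζ μ) (hζ : ∀ i, Measurable (ζ i)) (hB1 : 1 ≤ B)
include hind hζ hB1

theorem secondMomentLe_linear (ha : CenteredSqBounded μ ζ B a) (w : ι → ℝ) :
    SecondMomentLe μ (fun ω => ∑ i, w i * a i (ζ i ω)) (B * ∑ i, w i ^ 2) := by
  have hprob := hind.isProbabilityMeasure
  have := secondMomentLe_multilinear (m := 1) (N := 1) hind hζ (Finset.univ : Finset ι)
    (fun i => {i}) (fun i l x => if l = i then a l x else 1) w hB1 ?_ ?_ ?_ ?_ ?_ ?_ ?_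
  · simpa using this
  · intro s _ i; split_ifs; exacts [ha.meas i, measurable_const]
  · intro s _ i; split_ifs; exacts [ha.memLp i, memLp_const _]
  · intro s _ i hi; simp only [Finset.mem_singleton] at hi; subst hi; simpa using ha.sq_le i
  · intro s _ i hi; simp only [Finset.mem_singleton] at hi; subst hi; simpa using ha.mean i
  · intro s _ i hi x; simp only [Finset.mem_singleton] at hi; simp [hi]
  · simp
  · intro s _
    refine Finset.card_le_one.2 ?_
    simp

theorem secondMomentLe_bilinear (ha : CenteredSqBounded μ ζ B a)
    (hb : CenteredSqBounded μ ζ B b) (w : ι → ι → ℝ) :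
    SecondMomentLe μ
      (fun ω => ∑ i, ∑ j ∈ Finset.univ.erase i, w i j * (a i (ζ i ω) * b j (ζ j ω)))
      (4 * B ^ 2 * ∑ i, ∑ j ∈ Finset.univ.erase i, w i j ^ 2) := by
  have hprob := hind.isProbabilityMeasure
  have := secondMomentLe_multilinear (m := 2) (N := 4) hind hζ
    ((Finset.univ : Finset (ι × ι)).filter fun s => s.2 ≠ s.1)
    (fun s => {s.1, s.2})
    (fun s l x => (if l = s.1 then a l x else 1) * (if l = s.2 then b l x else 1))
    (fun s => w s.1 s.2) hB1 ?_ ?_ ?_ ?_ ?_ ?_ ?_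
  · have e : ∀ f : ι → ι → ℝ, ∑ s ∈ (Finset.univ : Finset (ι × ι)).filter (fun s => s.2 ≠ s.1),
        f s.1 s.2 = ∑ i, ∑ j ∈ Finset.univ.erase i, f i j := by
      intro f
      rw [Finset.sum_filter, Fintype.sum_prod_type]
      refine Finset.sum_congr rfl fun i _ => ?_
      rw [← Finset.sum_filter]
      exact Finset.sum_congr (by ext; simp) fun _ _ => rfl
    simp only [Finset.prod_mul_distrib, Finset.prod_ite_eq', Finset.mem_univ, if_true] at this
    rw [e (fun i j => w i j ^ 2)] at this
    have e' := fun ω => e fun i j => w i j * (a i (ζ i ω) * b j (ζ j ω))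
    simp only [e'] at this
    exact_mod_cast this
  · intro s _ i; refine Measurable.mul ?_ ?_ <;> split_ifs
    exacts [ha.meas i, measurable_const, hb.meas i, measurable_const]
  · rintro ⟨i, j⟩ hs l
    have hs : j ≠ i := by simpa using hs
    by_cases h1 : l = i
    · subst h1; simpa [hs.symm] using ha.memLp l
    · by_cases h2 : l = j
      · subst h2; simpa [hs] using hb.memLp l
      · simpa [h1, h2] using memLp_const (1 : ℝ)
  · rintro ⟨i, j⟩ hs l hl
    have hs : j ≠ i := by simpa using hs
    simp only [Finset.mem_insert, Finset.mem_singleton] at hl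
    obtain rfl | rfl := hl
    · simpa [hs.symm] using ha.sq_le l
    · simpa [hs] using hb.sq_le l
  · rintro ⟨i, j⟩ hs l hl
    have hs : j ≠ i := by simpa using hs
    simp only [Finset.mem_insert, Finset.mem_singleton] at hl
    obtain rfl | rfl := hl
    · simpa [hs.symm] using ha.mean l
    · simpa [hs] using hb.mean l
  · rintro ⟨i, j⟩ hs l hl x
    simp only [Finset.mem_insert, Finset.mem_singleton, not_or] at hl
    simp [hl.1, hl.2]
  · exact fun s _ => Finset.card_le_two
  · rintro s -
    -- A pair with the same key has both entries in that key, whence the crude count 2 · 2; the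
    -- trilinear case gives 3 · 3 · 3 in the same way.
    calc _ ≤ (({s.1, s.2} : Finset ι) ×ˢ ({s.1, s.2} : Finset ι)).card := by
          refine Finset.card_le_card fun t ht => ?_
          have h := (Finset.mem_filter.1 ht).2
          rw [Finset.mem_product, ← h]
          simp
      _ ≤ 2 * 2 := by
          rw [Finset.card_product]
          exact Nat.mul_le_mul Finset.card_le_two Finset.card_le_two

theorem secondMomentLe_trilinear (ha : CenteredSqBounded μ ζ B a)
    (hb : CenteredSqBounded μ ζ B b) (hc : CenteredSqBounded μ ζ B c) (w : ι → ι → ι → ℝ) :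
    SecondMomentLe μ
      (fun ω => ∑ i, ∑ j ∈ Finset.univ.erase i, ∑ k ∈ (Finset.univ.erase i).erase j,
        w i j k * (a i (ζ i ω) * b j (ζ j ω) * c k (ζ k ω)))
      (27 * B ^ 3 * ∑ i, ∑ j ∈ Finset.univ.erase i, ∑ k ∈ (Finset.univ.erase i).erase j,
        w i j k ^ 2) := by
  have hprob := hind.isProbabilityMeasure
  have := secondMomentLe_multilinear (m := 3) (N := 27) hind hζ
    ((Finset.univ : Finset (ι × ι × ι)).filter fun s => s.2.1 ≠ s.1 ∧ s.2.2 ≠ s.2.1 ∧ s.2.2 ≠ s.1)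
    (fun s => {s.1, s.2.1, s.2.2})
    (fun s l x => (if l = s.1 then a l x else 1) * (if l = s.2.1 then b l x else 1)
      * (if l = s.2.2 then c l x else 1))
    (fun s => w s.1 s.2.1 s.2.2) hB1 ?_ ?_ ?_ ?_ ?_ ?_ ?_
  · have e : ∀ f : ι → ι → ι → ℝ, ∑ s ∈ (Finset.univ : Finset (ι × ι × ι)).filter
          (fun s => s.2.1 ≠ s.1 ∧ s.2.2 ≠ s.2.1 ∧ s.2.2 ≠ s.1), f s.1 s.2.1 s.2.2
        = ∑ i, ∑ j ∈ Finset.univ.erase i, ∑ k ∈ (Finset.univ.erase i).erase j, f i j k := by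
      intro f
      rw [Finset.sum_filter, Fintype.sum_prod_type]
      refine Finset.sum_congr rfl fun i _ => ?_
      rw [Fintype.sum_prod_type, ← Finset.sum_subset (Finset.subset_univ (Finset.univ.erase i))]
      · refine Finset.sum_congr rfl fun j hj => ?_
        rw [← Finset.sum_filter]
        refine Finset.sum_congr ?_ fun _ _ => rfl
        ext k
        simp [Finset.ne_of_mem_erase hj]
      · intro j _ hj
        have : j = i := by simpa using hj
        simp [this]
    simp only [Finset.prod_mul_distrib, Finset.prod_ite_eq', Finset.mem_univ, if_true] at this
    rw [e (fun i j k => w i j k ^ 2)] at this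
    have e' := fun ω => e fun i j k => w i j k * (a i (ζ i ω) * b j (ζ j ω) * c k (ζ k ω))
    simp only [e'] at this
    exact_mod_cast this
  · intro s _ i; refine Measurable.mul (Measurable.mul ?_ ?_) ?_ <;> split_ifs
    exacts [ha.meas i, measurable_const, hb.meas i, measurable_const, hc.meas i, measurable_const]
  · rintro ⟨i, j, k⟩ hs l
    obtain ⟨h1, h2, h3⟩ : j ≠ i ∧ k ≠ j ∧ k ≠ i := by simpa using hs
    by_cases hi : l = i
    · subst hi; simpa [h1.symm, h3.symm] using ha.memLp l
    · by_cases hj : l = j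
      · subst hj; simpa [h1, h2.symm] using hb.memLp l
      · by_cases hk : l = k
        · subst hk; simpa [h2, h3] using hc.memLp l
        · simpa [hi, hj, hk] using memLp_const (1 : ℝ)
  · rintro ⟨i, j, k⟩ hs l hl
    obtain ⟨h1, h2, h3⟩ : j ≠ i ∧ k ≠ j ∧ k ≠ i := by simpa using hs
    simp only [Finset.mem_insert, Finset.mem_singleton] at hl
    obtain rfl | rfl | rfl := hl
    · simpa [h1.symm, h3.symm] using ha.sq_le l
    · simpa [h1, h2.symm] using hb.sq_le l
    · simpa [h2, h3] using hc.sq_le l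
  · rintro ⟨i, j, k⟩ hs l hl
    obtain ⟨h1, h2, h3⟩ : j ≠ i ∧ k ≠ j ∧ k ≠ i := by simpa using hs
    simp only [Finset.mem_insert, Finset.mem_singleton] at hl
    obtain rfl | rfl | rfl := hl
    · simpa [h1.symm, h3.symm] using ha.mean l
    · simpa [h1, h2.symm] using hb.mean l
    · simpa [h2, h3] using hc.mean l
  · rintro ⟨i, j, k⟩ hs l hl x
    simp only [Finset.mem_insert, Finset.mem_singleton, not_or] at hl
    simp [hl.1, hl.2.1, hl.2.2]
  · exact fun s _ => Finset.card_le_three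
  · rintro s -
    calc _ ≤ (({s.1, s.2.1, s.2.2} : Finset ι) ×ˢ
            (({s.1, s.2.1, s.2.2} : Finset ι) ×ˢ ({s.1, s.2.1, s.2.2} : Finset ι))).card := by
          refine Finset.card_le_card fun t ht => ?_
          have h := (Finset.mem_filter.1 ht).2
          rw [Finset.mem_product, Finset.mem_product, ← h]
          simp
      _ ≤ 3 * (3 * 3) := by
          rw [Finset.card_product, Finset.card_product]
          exact Nat.mul_le_mul Finset.card_le_three
            (Nat.mul_le_mul Finset.card_le_three Finset.card_le_three)

end Forms

end SecondMoment

/-! ### Symmetric idempotent matrices -/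

section Projection

variable {ι : Type*} [Fintype ι]

/-- `P` is a symmetric idempotent matrix. -/
structure IsSymmIdem (P : Matrix ι ι ℝ) : Prop where
  symm : ∀ i j, P i j = P j i
  idem : ∀ i j, ∑ k, P i k * P k j = P i j

namespace IsSymmIdem

variable {P : Matrix ι ι ℝ} (hP : IsSymmIdem P)
include hP

theorem sum_sq_row (i : ι) : ∑ j, P i j ^ 2 = P i i := by
  rw [← hP.idem i i]
  exact Finset.sum_congr rfl fun j _ => by rw [sq, hP.symm j i]

theorem sum_sq : ∑ i, ∑ j, P i j ^ 2 = P.trace := by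
  simp only [hP.sum_sq_row]; rfl

theorem diag_nonneg (i : ι) : 0 ≤ P i i := by
  rw [← hP.sum_sq_row]; positivity

theorem diag_le_one (i : ι) : P i i ≤ 1 := by
  have h : P i i ^ 2 ≤ P i i := by
    conv_rhs => rw [← hP.sum_sq_row i]
    exact Finset.single_le_sum (f := fun j => P i j ^ 2) (fun j _ => sq_nonneg _)
      (Finset.mem_univ i)
  nlinarith [hP.diag_nonneg i]

theorem sq_le_one (i j : ι) : P i j ^ 2 ≤ 1 := by
  refine le_trans ?_ (hP.diag_le_one i)
  rw [← hP.sum_sq_row i]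
  exact Finset.single_le_sum (f := fun j => P i j ^ 2) (fun j _ => sq_nonneg _)
    (Finset.mem_univ j)

theorem sum_sq_apply (u : ι → ℝ) :
    ∑ i, (∑ j, P i j * u j) ^ 2 = ∑ j, u j * ∑ k, P j k * u k := by
  have : ∀ i, (∑ j, P i j * u j) ^ 2 = ∑ j, ∑ k, u j * u k * (P j i * P i k) := by
    intro i
    rw [sq, Finset.sum_mul_sum]
    exact Finset.sum_congr rfl fun j _ => Finset.sum_congr rfl fun k _ => by
      rw [hP.symm j i]; ring
  simp only [this]
  rw [Finset.sum_comm]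
  refine Finset.sum_congr rfl fun j _ => ?_
  rw [Finset.sum_comm, Finset.mul_sum]
  refine Finset.sum_congr rfl fun k _ => ?_
  rw [← Finset.mul_sum, hP.idem]; ring

/-- ‖u - Pu‖² ≥ 0 together with ‖Pu‖² = ⟨u, Pu⟩. -/
theorem sum_sq_apply_le (u : ι → ℝ) : ∑ i, (∑ j, P i j * u j) ^ 2 ≤ ∑ i, u i ^ 2 := by
  have h : 0 ≤ ∑ i, (u i - ∑ j, P i j * u j) ^ 2 := Finset.sum_nonneg fun _ _ => sq_nonneg _
  have e : ∑ i, (u i - ∑ j, P i j * u j) ^ 2 = ∑ i, u i ^ 2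
      - 2 * (∑ i, u i * ∑ j, P i j * u j) + ∑ i, (∑ j, P i j * u j) ^ 2 := by
    rw [Finset.mul_sum, ← Finset.sum_sub_distrib, ← Finset.sum_add_distrib]
    exact Finset.sum_congr rfl fun _ _ => by ring
  linarith [hP.sum_sq_apply u]

variable [DecidableEq ι]

/-- Leaving out the diagonal changes (Pu)_i by P_ii u_i, which is at most |u_i|, so the bound is
2‖Pu‖² + 2‖u‖². -/
theorem sum_sq_offDiag_apply_le (u : ι → ℝ) :
    ∑ i, (∑ j ∈ Finset.univ.erase i, P i j * u j) ^ 2 ≤ 4 * ∑ i, u i ^ 2 := by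
  have h : ∀ i, (∑ j ∈ Finset.univ.erase i, P i j * u j) ^ 2
      ≤ 2 * (∑ j, P i j * u j) ^ 2 + 2 * u i ^ 2 := by
    intro i
    have e := Finset.add_sum_erase Finset.univ (fun j => P i j * u j) (Finset.mem_univ i)
    have h1 : (P i i * u i) ^ 2 ≤ u i ^ 2 := by
      rw [mul_pow]
      exact mul_le_of_le_one_left (sq_nonneg _) (hP.sq_le_one i i)
    rw [eq_sub_of_add_eq' e]
    nlinarith [sq_nonneg (∑ j, P i j * u j + P i i * u i)]
  refine (Finset.sum_le_sum fun i _ => h i).trans ?_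
  rw [Finset.sum_add_distrib, ← Finset.mul_sum, ← Finset.mul_sum]
  linarith [hP.sum_sq_apply_le u]

/-- Cauchy–Schwarz for P_ij · (P_ij u_j), using that the squares in a row sum to P_ii ≤ 1. -/
theorem sum_sq_weighted_row_le {u : ι → ℝ} {B : ℝ} (hu : ∀ i, u i ^ 2 ≤ B) :
    ∑ i, (∑ j ∈ Finset.univ.erase i, P i j ^ 2 * u j) ^ 2 ≤ B * P.trace := by
  rw [← hP.sum_sq, Finset.mul_sum]
  refine Finset.sum_le_sum fun i _ => ?_
  have h1 : ∑ j ∈ Finset.univ.erase i, P i j ^ 2 ≤ 1 :=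
    (Finset.sum_le_sum_of_subset_of_nonneg (Finset.subset_univ _) fun _ _ _ => sq_nonneg _).trans
      ((hP.sum_sq_row i).trans_le (hP.diag_le_one i))
  calc (∑ j ∈ Finset.univ.erase i, P i j ^ 2 * u j) ^ 2
      = (∑ j ∈ Finset.univ.erase i, P i j * (P i j * u j)) ^ 2 := by
        congr 1; exact Finset.sum_congr rfl fun _ _ => by ring
    _ ≤ (∑ j ∈ Finset.univ.erase i, P i j ^ 2) * ∑ j ∈ Finset.univ.erase i, (P i j * u j) ^ 2 :=
        Finset.sum_mul_sq_le_sq_mul_sq _ _ _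
    _ ≤ 1 * ∑ j ∈ Finset.univ.erase i, (P i j * u j) ^ 2 := by gcongr
    _ ≤ ∑ j, (P i j * u j) ^ 2 := by
        rw [one_mul]
        exact Finset.sum_le_sum_of_subset_of_nonneg (Finset.subset_univ _) fun _ _ _ => sq_nonneg _
    _ ≤ B * ∑ j, P i j ^ 2 := by
        rw [Finset.mul_sum]
        refine Finset.sum_le_sum fun j _ => ?_
        rw [mul_pow, mul_comm]
        exact mul_le_mul_of_nonneg_right (hu j) (sq_nonneg _)

theorem sum_offDiag_sq_le : ∑ i, ∑ j ∈ Finset.univ.erase i, P i j ^ 2 ≤ P.trace := by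
  rw [← hP.sum_sq]
  exact Finset.sum_le_sum fun i _ =>
    Finset.sum_le_sum_of_subset_of_nonneg (Finset.subset_univ _) fun _ _ _ => sq_nonneg _

theorem sum_offDiag_pow_four_le :
    ∑ i, ∑ j ∈ Finset.univ.erase i, (P i j ^ 2) ^ 2 ≤ P.trace := by
  refine le_trans (Finset.sum_le_sum fun i _ => Finset.sum_le_sum fun j _ => ?_)
    hP.sum_offDiag_sq_le
  rw [sq]
  exact mul_le_of_le_one_left (sq_nonneg _) (hP.sq_le_one i j)

theorem sum_triple_sq_le :
    ∑ i, ∑ j ∈ Finset.univ.erase i, ∑ k ∈ (Finset.univ.erase i).erase j,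
      (P i j * P i k) ^ 2 ≤ P.trace := by
  refine le_trans (Finset.sum_le_sum fun i _ => Finset.sum_le_sum fun j _ => ?_)
    hP.sum_offDiag_sq_le
  calc _ ≤ ∑ k, (P i j * P i k) ^ 2 :=
        Finset.sum_le_sum_of_subset_of_nonneg (Finset.subset_univ _) fun _ _ _ => sq_nonneg _
    _ = P i j ^ 2 * P i i := by
        rw [← hP.sum_sq_row, Finset.mul_sum]
        exact Finset.sum_congr rfl fun _ _ => by ring
    _ ≤ P i j ^ 2 := mul_le_of_le_one_right (sq_nonneg _) (hP.diag_le_one i)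

omit [DecidableEq ι] in
-- The left side is the squared Frobenius norm of P diag(c) P. Idempotence, used once in j and once
-- in k, turns it into ∑ c_i c_l P_il², and c_i c_l ≤ B.
theorem sum_sq_sandwich_le {c : ι → ℝ} {B : ℝ} (hc : ∀ i, c i ^ 2 ≤ B) :
    ∑ j, ∑ k, (∑ i, P i j * P i k * c i) ^ 2 ≤ B * P.trace := by
  have e : ∑ j, ∑ k, (∑ i, P i j * P i k * c i) ^ 2 = ∑ i, ∑ l, c i * c l * P i l ^ 2 := by
    have h1 : ∀ j k, (∑ i, P i j * P i k * c i) ^ 2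
        = ∑ i, ∑ l, c i * c l * (P i j * P j l) * (P i k * P k l) := by
      intro j k
      rw [sq, Finset.sum_mul_sum]
      exact Finset.sum_congr rfl fun i _ => Finset.sum_congr rfl fun l _ => by
        rw [hP.symm j l, hP.symm k l]; ring
    simp only [h1]
    calc _ = ∑ j, ∑ i, ∑ l, ∑ k, c i * c l * (P i j * P j l) * (P i k * P k l) := by
          refine Finset.sum_congr rfl fun j _ => ?_
          rw [Finset.sum_comm]
          exact Finset.sum_congr rfl fun i _ => Finset.sum_comm
      _ = ∑ i, ∑ l, ∑ j, ∑ k, c i * c l * (P i j * P j l) * (P i k * P k l) := by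
          rw [Finset.sum_comm]
          exact Finset.sum_congr rfl fun i _ => Finset.sum_comm
      _ = _ := by
          refine Finset.sum_congr rfl fun i _ => Finset.sum_congr rfl fun l _ => ?_
          simp only [← Finset.mul_sum, hP.idem, ← Finset.sum_mul]
          ring
  rw [e, ← hP.sum_sq, Finset.mul_sum]
  refine Finset.sum_le_sum fun i _ => ?_
  rw [Finset.mul_sum]
  refine Finset.sum_le_sum fun l _ => mul_le_mul_of_nonneg_right ?_ (sq_nonneg _)
  nlinarith [sq_nonneg (c i - c l), hc i, hc l]

theorem sum_sq_offDiag_sandwich_le {c : ι → ℝ} {B : ℝ} (hc : ∀ i, c i ^ 2 ≤ B) :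
    ∑ j, ∑ k ∈ Finset.univ.erase j,
      (∑ i ∈ (Finset.univ.erase j).erase k, P i j * P i k * c i) ^ 2 ≤ 9 * B * P.trace := by
  have h : ∀ j, ∀ k ∈ Finset.univ.erase j,
      (∑ i ∈ (Finset.univ.erase j).erase k, P i j * P i k * c i) ^ 2
      ≤ 3 * (∑ i, P i j * P i k * c i) ^ 2 + 6 * (B * P j k ^ 2) := by
    intro j k hk
    have e1 := Finset.add_sum_erase Finset.univ (fun i => P i j * P i k * c i) (Finset.mem_univ j)
    have e2 := Finset.add_sum_erase _ (fun i => P i j * P i k * c i) hk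
    have key : ∀ x y : ℝ, ∀ i, x ^ 2 ≤ 1 → (x * y * c i) ^ 2 ≤ B * y ^ 2 := by
      intro x y i hx
      have : (x * y * c i) ^ 2 = x ^ 2 * (c i ^ 2 * y ^ 2) := by ring
      rw [this]
      exact (mul_le_of_le_one_left (by positivity) hx).trans
        (mul_le_mul_of_nonneg_right (hc i) (sq_nonneg _))
    have b1 := key (P j j) (P j k) j (hP.sq_le_one _ _)
    have b2 := key (P k k) (P k j) k (hP.sq_le_one _ _)
    rw [mul_comm (P k k) (P k j), hP.symm k j] at b2
    rw [hP.symm k j] at e2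
    set s := ∑ i, P i j * P i k * c i
    set r := ∑ i ∈ (Finset.univ.erase j).erase k, P i j * P i k * c i
    have hr : r = s - P j j * P j k * c j - P j k * P k k * c k := by linarith
    rw [hr]
    -- This is (s - x - y)² ≤ 3(s² + x² + y²), where the two removed terms satisfy x², y² ≤ B P_jk².
    -- Summation gives 3B + 6B = 9B times the trace.
    nlinarith [sq_nonneg (s + P j j * P j k * c j), sq_nonneg (s + P j k * P k k * c k),
      sq_nonneg (P j j * P j k * c j - P j k * P k k * c k)]
  refine (Finset.sum_le_sum fun j _ => Finset.sum_le_sum (h j)).trans ?_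
  calc _ ≤ ∑ j, ∑ k, (3 * (∑ i, P i j * P i k * c i) ^ 2 + 6 * (B * P j k ^ 2)) := by
        refine Finset.sum_le_sum fun j _ =>
          Finset.sum_le_sum_of_subset_of_nonneg (Finset.subset_univ _) fun k _ _ => ?_
        have : 0 ≤ B := (sq_nonneg _).trans (hc j)
        positivity
    _ = 3 * ∑ j, ∑ k, (∑ i, P i j * P i k * c i) ^ 2 + 6 * (B * ∑ j, ∑ k, P j k ^ 2) := by
        simp only [Finset.sum_add_distrib, Finset.mul_sum]
    _ ≤ _ := by
        rw [hP.sum_sq]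
        linarith [hP.sum_sq_sandwich_le hc]

end IsSymmIdem

end Projection

/-! ### The matrix of the design is an orthogonal projection of trace K. -/

namespace IVModel

variable {n k : ℕ} {Ω : Type*} (M : IVModel n k Ω)

/-- If ZᵀZ were singular, its inverse would be 0 by convention, so P = 0 and k = 0; but the empty
determinant is 1. -/
theorem isUnit_det_of_rank (h : M.P.rank = k) : IsUnit (M.Z.transpose * M.Z).det := by
  by_contra hdet
  have h0 : (M.Z.transpose * M.Z)⁻¹ = 0 := Matrix.nonsing_inv_apply_not_isUnit _ hdet
  have hk : k = 0 := by
    rw [← h, P, h0]; simp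
  subst hk
  exact hdet (by simp)

theorem isSymmIdem_P (h : M.P.rank = k) : IsSymmIdem M.P := by
  have hu := M.isUnit_det_of_rank h
  constructor
  · intro i j
    have : M.P.transpose = M.P := by
      simp only [P, Matrix.transpose_mul, Matrix.transpose_nonsing_inv, Matrix.transpose_transpose,
        Matrix.mul_assoc]
    calc M.P i j = M.P.transpose j i := rfl
      _ = M.P j i := by rw [this]
  · intro i j
    suffices h2 : M.P * M.P = M.P by rw [← Matrix.mul_apply, h2]
    simp only [P]
    calc _ = M.Z * ((M.Z.transpose * M.Z)⁻¹ * (M.Z.transpose * M.Z))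
          * (M.Z.transpose * M.Z)⁻¹ * M.Z.transpose := by simp only [Matrix.mul_assoc]
      _ = _ := by rw [Matrix.nonsing_inv_mul _ hu, Matrix.mul_one]

theorem trace_P (h : M.P.rank = k) : M.P.trace = k := by
  have hu := M.isUnit_det_of_rank h
  rw [P, Matrix.mul_assoc, Matrix.trace_mul_comm, Matrix.mul_assoc, Matrix.nonsing_inv_mul _ hu]
  simp

end IVModel

/-! ### Decompositions of the statistics into multilinear forms -/

section Decomposition

variable {ι : Type*} [Fintype ι] [DecidableEq ι]

theorem sum_erase_comm (f : ι → ι → ℝ) :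
    ∑ i, ∑ j ∈ Finset.univ.erase i, f i j = ∑ j, ∑ i ∈ Finset.univ.erase j, f i j :=
  Finset.sum_comm' fun i j => by simp [eq_comm]

theorem sum_erase_erase_comm (f : ι → ι → ι → ℝ) :
    ∑ i, ∑ j ∈ Finset.univ.erase i, ∑ k ∈ (Finset.univ.erase i).erase j, f i j k
      = ∑ j, ∑ k ∈ Finset.univ.erase j, ∑ i ∈ (Finset.univ.erase j).erase k, f i j k := by
  calc _ = ∑ j, ∑ i ∈ Finset.univ.erase j, ∑ k ∈ (Finset.univ.erase i).erase j, f i j k :=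
        Finset.sum_comm' fun i j => by simp [eq_comm]
    _ = _ := by
        refine Finset.sum_congr rfl fun j _ => Finset.sum_comm' fun i k => ?_
        simp only [Finset.mem_erase, Finset.mem_univ, and_true, ne_eq]
        tauto

variable {P : Matrix ι ι ℝ}

/-- With a', b' the means of a, b, this is the Hoeffding decomposition: a bilinear form in centered
variables and two linear ones. Symmetry of `P` lets the second linear form be written with row sums.
-/
theorem IsSymmIdem.bilinear_decomp (hP : IsSymmIdem P) (a b a' b' : ι → ℝ) :
    ∑ i, ∑ j ∈ Finset.univ.erase i, P i j ^ 2 * (a i * b j)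
      - ∑ i, ∑ j ∈ Finset.univ.erase i, P i j ^ 2 * (a' i * b' j)
    = ∑ i, ∑ j ∈ Finset.univ.erase i, P i j ^ 2 * ((a i - a' i) * (b j - b' j))
      + (∑ i, (∑ j ∈ Finset.univ.erase i, P i j ^ 2 * b' j) * (a i - a' i)
      + ∑ i, (∑ j ∈ Finset.univ.erase i, P i j ^ 2 * a' j) * (b i - b' i)) := by
  have e : ∑ i, (∑ j ∈ Finset.univ.erase i, P i j ^ 2 * a' j) * (b i - b' i)
      = ∑ i, ∑ j ∈ Finset.univ.erase i, P i j ^ 2 * (a' i * (b j - b' j)) := by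
    rw [sum_erase_comm]
    refine Finset.sum_congr rfl fun i _ => ?_
    rw [Finset.sum_mul]
    exact Finset.sum_congr rfl fun j _ => by rw [hP.symm i j]; ring
  rw [e]
  simp only [Finset.sum_mul, ← Finset.sum_add_distrib, ← Finset.sum_sub_distrib]
  exact Finset.sum_congr rfl fun i _ => Finset.sum_congr rfl fun j _ => by ring

omit [Fintype ι] in
theorem sq_sum_eq_sum_sq_add (s : Finset ι) (x : ι → ℝ) :
    (∑ j ∈ s, x j) ^ 2 = ∑ j ∈ s, x j ^ 2 + ∑ j ∈ s, ∑ k ∈ s.erase j, x j * x k := by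
  rw [sq, Finset.sum_mul_sum, ← Finset.sum_add_distrib]
  refine Finset.sum_congr rfl fun j hj => ?_
  rw [← Finset.add_sum_erase s (fun k => x j * x k) hj, sq]

/-- The inner sum is om_i plus a noise sum. Its square is split into om_i², the cross term, the
diagonal j = k and the pairs j ≠ k. Apart from the diagonal, kept whole for the quadratic-form law,
each piece is split by c = c' + (c - c'), so that v and c - c' appear only in products over distinct
indices. -/
theorem IsSymmIdem.jackknife_decomp (hP : IsSymmIdem P) (p v c c' : ι → ℝ) :
    let om : ι → ℝ := fun i => ∑ j ∈ Finset.univ.erase i, P i j * p j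
    ∑ i, (∑ j ∈ Finset.univ.erase i, P i j * (p j + v j)) ^ 2 * c i
    = ∑ i, om i ^ 2 * c' i + (∑ i, om i ^ 2 * (c i - c' i)
      + (2 * ∑ i, ∑ j ∈ Finset.univ.erase i, om i * P i j * ((c i - c' i) * v j)
      + (2 * ∑ i, (∑ j ∈ Finset.univ.erase i, P i j * (om j * c' j)) * v i
      + (∑ i, ∑ j ∈ Finset.univ.erase i, P i j ^ 2 * (c i * v j ^ 2)
      + (∑ i, ∑ j ∈ Finset.univ.erase i, ∑ k ∈ (Finset.univ.erase i).erase j,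
          P i j * P i k * ((c i - c' i) * v j * v k)
      + ∑ j, ∑ k ∈ Finset.univ.erase j,
          (∑ i ∈ (Finset.univ.erase j).erase k, P i j * P i k * c' i) * (v j * v k)))))) := by
  intro om
  have e1 : ∑ i, (∑ j ∈ Finset.univ.erase i, P i j * (om j * c' j)) * v i
      = ∑ i, ∑ j ∈ Finset.univ.erase i, om i * P i j * (c' i * v j) := by
    rw [sum_erase_comm]
    refine Finset.sum_congr rfl fun i _ => ?_
    rw [Finset.sum_mul]
    exact Finset.sum_congr rfl fun j _ => by rw [hP.symm i j]; ring
  have e2 : ∑ j, ∑ k ∈ Finset.univ.erase j,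
          (∑ i ∈ (Finset.univ.erase j).erase k, P i j * P i k * c' i) * (v j * v k)
      = ∑ i, ∑ j ∈ Finset.univ.erase i, ∑ k ∈ (Finset.univ.erase i).erase j,
          P i j * P i k * (c' i * v j * v k) := by
    rw [sum_erase_erase_comm]
    refine Finset.sum_congr rfl fun j _ => Finset.sum_congr rfl fun k _ => ?_
    rw [Finset.sum_mul]
    exact Finset.sum_congr rfl fun i _ => by ring
  rw [e1, e2]
  simp only [Finset.mul_sum, ← Finset.sum_add_distrib]
  refine Finset.sum_congr rfl fun i _ => ?_
  have h1 : ∑ j ∈ Finset.univ.erase i, P i j * (p j + v j)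
      = om i + ∑ j ∈ Finset.univ.erase i, P i j * v j := by
    simp only [om, ← Finset.sum_add_distrib, mul_add]
  rw [h1]
  have h2 := sq_sum_eq_sum_sq_add (Finset.univ.erase i) fun j => P i j * v j
  calc _ = om i ^ 2 * c i + 2 * om i * c i * (∑ j ∈ Finset.univ.erase i, P i j * v j)
        + (∑ j ∈ Finset.univ.erase i, P i j * v j) ^ 2 * c i := by ring
    _ = om i ^ 2 * c' i + om i ^ 2 * (c i - c' i)
        + ∑ j ∈ Finset.univ.erase i, 2 * om i * c i * (P i j * v j)
        + ((∑ j ∈ Finset.univ.erase i, (P i j * v j) ^ 2) * c i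
          + (∑ j ∈ Finset.univ.erase i, ∑ k ∈ (Finset.univ.erase i).erase j,
            P i j * v j * (P i k * v k)) * c i) := by
        rw [h2, Finset.mul_sum]; ring
    _ = _ := by
        simp only [Finset.sum_mul, add_assoc]
        congr 2
        simp only [← Finset.sum_add_distrib]
        refine Finset.sum_congr rfl fun j _ => ?_
        calc _ = 2 * (om i * P i j * ((c i - c' i) * v j)) + (2 * (om i * P i j * (c' i * v j))
              + (P i j ^ 2 * (c i * v j ^ 2)
              + ∑ k ∈ (Finset.univ.erase i).erase j, (P i j * P i k * ((c i - c' i) * v j * v k)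
              + P i j * P i k * (c' i * v j * v k)))) := by
              have : ∑ k ∈ (Finset.univ.erase i).erase j, P i j * v j * (P i k * v k) * c i
                  = ∑ k ∈ (Finset.univ.erase i).erase j,
                    (P i j * P i k * ((c i - c' i) * v j * v k)
                    + P i j * P i k * (c' i * v j * v k)) :=
                Finset.sum_congr rfl fun k _ => by ring
              rw [this]; ring
          _ = _ := by rw [Finset.sum_add_distrib]

end Decomposition

/-! ### Convergence in probability along an array -/

section LittleOProb

variable {Ω : ℕ → Type*} [∀ n, MeasurableSpace (Ω n)] {μ : ∀ n, Measure (Ω n)}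

namespace IsLittleOProb

theorem of_tendsto_zero {x : ℕ → ℝ} (hx : Tendsto x atTop (𝓝 0)) :
    IsLittleOProb μ fun n _ => x n := by
  intro ε hε
  refine tendsto_const_nhds.congr' ?_
  filter_upwards [hx.eventually (Metric.ball_mem_nhds 0 hε)] with n hn
  have h : ¬ ε ≤ ‖x n‖ := by simpa [Metric.mem_ball] using hn
  simp only [h, Set.ofPred_false, measure_empty]

section

variable {E : Type*} [NormedAddCommGroup E] {T T' : ∀ n, Ω n → E}

theorem add (hT : IsLittleOProb μ T) (hT' : IsLittleOProb μ T') :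
    IsLittleOProb μ fun n ω => T n ω + T' n ω := by
  intro ε hε
  have h := (hT (ε / 2) (half_pos hε)).add (hT' (ε / 2) (half_pos hε))
  rw [add_zero] at h
  refine tendsto_of_tendsto_of_tendsto_of_le_of_le tendsto_const_nhds h (fun _ => zero_le) fun n => ?_
  refine (measure_mono fun ω hω => ?_).trans (measure_union_le _ _)
  by_contra hcon
  simp only [Set.mem_union, Set.mem_ofPred_eq, not_or, not_le] at hcon hω
  linarith [norm_add_le (T n ω) (T' n ω)]

theorem of_norm_le {E' : Type*} [NormedAddCommGroup E'] {T' : ∀ n, Ω n → E'}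
    (hT' : IsLittleOProb μ T') (h : ∀ n ω, ‖T n ω‖ ≤ ‖T' n ω‖) : IsLittleOProb μ T := by
  intro ε hε
  exact tendsto_of_tendsto_of_tendsto_of_le_of_le tendsto_const_nhds (hT' ε hε)
    (fun _ => zero_le) fun n => measure_mono fun ω hω => le_trans hω (h n ω)

end

variable {T : ∀ n, Ω n → ℝ}

theorem bdd_mul (hT : IsLittleOProb μ T) {c : ℕ → ℝ} (hc : ∃ C, ∀ n, |c n| ≤ C) :
    IsLittleOProb μ fun n ω => c n * T n ω := by
  obtain ⟨C, hC⟩ := hc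
  have hC' : ∀ n, |c n| ≤ |C| + 1 := fun n => by linarith [hC n, le_abs_self C]
  intro ε hε
  have hpos : 0 < |C| + 1 := by positivity
  refine tendsto_of_tendsto_of_tendsto_of_le_of_le tendsto_const_nhds
    (hT (ε / (|C| + 1)) (by positivity)) (fun _ => zero_le) fun n => measure_mono fun ω hω => ?_
  simp only [Set.mem_ofPred_eq, norm_mul, Real.norm_eq_abs] at hω ⊢
  rw [div_le_iff₀ hpos]
  calc ε ≤ |c n| * |T n ω| := hω
    _ ≤ (|C| + 1) * |T n ω| := mul_le_mul_of_nonneg_right (hC' n) (abs_nonneg _)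
    _ = _ := mul_comm _ _

theorem const_mul (hT : IsLittleOProb μ T) (c : ℝ) : IsLittleOProb μ fun n ω => c * T n ω :=
  hT.bdd_mul ⟨|c|, fun _ => le_rfl⟩

theorem sum {I : Type*} (s : Finset I) {T : I → ∀ n, Ω n → ℝ} (h : ∀ i ∈ s, IsLittleOProb μ (T i)) :
    IsLittleOProb μ fun n ω => ∑ i ∈ s, T i n ω := by
  classical
  induction s using Finset.induction_on with
  | empty => simpa using of_tendsto_zero (μ := μ) (x := fun _ => 0) tendsto_const_nhds
  | insert i s hi ih =>
    simp only [Finset.sum_insert hi]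
    exact (h i (Finset.mem_insert_self i s)).add
      (ih fun j hj => h j (Finset.mem_insert_of_mem hj))

theorem euclidean {m : ℕ} {T : ∀ n, Ω n → EuclideanSpace ℝ (Fin m)}
    (h : ∀ i, IsLittleOProb μ fun n ω => T n ω i) : IsLittleOProb μ T := by
  have habs : ∀ i, IsLittleOProb μ fun n ω => |T n ω i| :=
    fun i => (h i).of_norm_le fun n ω => by simp
  refine (IsLittleOProb.sum Finset.univ fun i _ => habs i).of_norm_le fun n ω => ?_
  have h0 : 0 ≤ ∑ i, |T n ω i| := Finset.sum_nonneg fun _ _ => abs_nonneg _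
  rw [Real.norm_eq_abs, abs_of_nonneg h0, EuclideanSpace.norm_eq]
  refine Real.sqrt_le_iff.2 ⟨h0, ?_⟩
  simp only [Real.norm_eq_abs]
  exact Finset.sum_sq_le_sq_sum_of_nonneg fun _ _ => abs_nonneg _

/-- Chebyshev's inequality. The normalization may vanish: then 1 / k n = 0 and nothing is to be
shown. -/
theorem of_secondMomentLe [∀ n, IsFiniteMeasure (μ n)] {k d : ℕ → ℝ}
    (hT : ∀ n, SecondMomentLe (μ n) (T n) (k n ^ 2 * d n)) (hd : Tendsto d atTop (𝓝 0)) :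
    IsLittleOProb μ fun n ω => 1 / k n * T n ω := by
  intro ε hε
  have hbound : ∀ n, (μ n) {ω | ε ≤ ‖1 / k n * T n ω‖} ≤ ENNReal.ofReal (|d n| / ε ^ 2) := by
    intro n
    by_cases hk : k n = 0
    · have : ¬ ε ≤ 0 := not_le.2 hε
      simp [hk, this]
    have hint : Integrable (fun ω => (1 / k n * T n ω) ^ 2) (μ n) := by
      simp only [mul_pow]; exact (hT n).1.const_mul _
    have h1 := mul_meas_ge_le_integral_of_nonneg (ae_of_all _ fun ω => sq_nonneg _) hint (ε ^ 2)
    have h2 : ∫ ω, (1 / k n * T n ω) ^ 2 ∂(μ n) ≤ |d n| := by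
      simp only [mul_pow]
      rw [integral_const_mul]
      calc _ ≤ (1 / k n) ^ 2 * (k n ^ 2 * d n) :=
            mul_le_mul_of_nonneg_left (hT n).2 (sq_nonneg _)
        _ = d n := by field_simp
        _ ≤ |d n| := le_abs_self _
    have hset : {ω | ε ≤ ‖1 / k n * T n ω‖} = {ω | ε ^ 2 ≤ (1 / k n * T n ω) ^ 2} := by
      ext ω
      simp only [Set.mem_ofPred_eq, Real.norm_eq_abs]
      rw [← sq_abs (1 / k n * T n ω), sq_le_sq₀ hε.le (abs_nonneg _)]
    rw [hset, ← ofReal_measureReal]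
    refine ENNReal.ofReal_le_ofReal ?_
    rw [le_div_iff₀ (by positivity), mul_comm]
    exact h1.trans h2
  refine tendsto_of_tendsto_of_tendsto_of_le_of_le tendsto_const_nhds ?_ (fun _ => zero_le) hbound
  have h := ENNReal.tendsto_ofReal ((hd.abs).div_const (ε ^ 2))
  simpa using h

end IsLittleOProb

end LittleOProb

/-! ### Laws of large numbers for the quadratic and the jackknife forms -/

section Forms

theorem SecondMomentLe.mono {Ω : Type*} [MeasurableSpace Ω] {μ : Measure Ω} {X : Ω → ℝ}
    {c d : ℝ} (h : SecondMomentLe μ X c) (hcd : c ≤ d) : SecondMomentLe μ X d :=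
  ⟨h.1, h.2.trans hcd⟩

variable {K : ℕ → ℕ} {Ω : ℕ → Type*} [∀ n, MeasurableSpace (Ω n)]
  {μ : ∀ n, Measure (Ω n)} {S : Type*} [MeasurableSpace S] {ζ : ∀ n, Fin n → Ω n → S}
  {P : ∀ n, Matrix (Fin n) (Fin n) ℝ} {B : ℝ} {a b c v : ∀ n, Fin n → S → ℝ}
  {p : ∀ n, Fin n → ℝ}

variable (hK : Tendsto K atTop atTop) (hP : ∀ n, IsSymmIdem (P n))
  (htr : ∀ n, (P n).trace = K n) (hind : ∀ n, iIndepFun (ζ n) (μ n))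
  (hζ : ∀ n i, Measurable (ζ n i)) (hB : 1 ≤ B)

include hK in
theorem tendsto_const_mul_inv_natCast (C : ℝ) :
    Tendsto (fun n => C * (K n : ℝ)⁻¹) atTop (𝓝 0) := by
  have h := (tendsto_natCast_atTop_atTop (R := ℝ)).comp hK
  simpa using (tendsto_inv_atTop_zero.comp h).const_mul C

/-- Also true for k = 0, where both sides are 0; this spares a case distinction for small n. -/
theorem natCast_sq_mul_inv (C : ℝ) (k : ℕ) : (k : ℝ) ^ 2 * (C * (k : ℝ)⁻¹) = C * k := by
  by_cases hk : (k : ℝ) = 0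
  · simp [hk]
  · field_simp

section

include hP htr

/-- The factor K · (‖p‖²/K) exposes the ratio that tends to 0. For K = 0 the trace vanishes, hence
so does `P`. -/
theorem sum_sq_offDiag_le (p : ∀ n, Fin n → ℝ) (n : ℕ) :
    ∑ i, (∑ j ∈ Finset.univ.erase i, P n i j * p n j) ^ 2
      ≤ 4 * ((K n : ℝ) * ((∑ i, p n i ^ 2) / (K n : ℝ))) := by
  by_cases hn : (K n : ℝ) = 0
  · have h0 : ∀ i j, P n i j = 0 := by
      have h := (hP n).sum_sq
      rw [htr, hn] at h
      intro i j
      have h2 := (Finset.sum_eq_zero_iff_of_nonneg fun i _ =>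
        Finset.sum_nonneg fun j _ => sq_nonneg (P n i j)).1 h i (Finset.mem_univ i)
      simpa using (Finset.sum_eq_zero_iff_of_nonneg fun j _ => sq_nonneg (P n i j)).1
        h2 j (Finset.mem_univ j)
    simp [h0, hn]
  · rw [mul_div_cancel₀ _ hn]
    exact (hP n).sum_sq_offDiag_apply_le (p n)

include hK

theorem tendsto_sum_sq_offDiag_mul {x : ∀ n, Fin n → ℝ} (hx : ∀ n i, |x n i| ≤ B)
    (hp : Tendsto (fun n => (∑ i, p n i ^ 2) / (K n : ℝ)) atTop (𝓝 0)) :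
    Tendsto (fun n => 1 / (K n : ℝ) *
      ∑ i, (∑ j ∈ Finset.univ.erase i, P n i j * p n j) ^ 2 * x n i) atTop (𝓝 0) := by
  refine squeeze_zero_norm' (a := fun n => |B| * (4 * ((∑ i, p n i ^ 2) / (K n : ℝ)))) ?_
    (by simpa using (hp.const_mul 4).const_mul |B|)
  filter_upwards [hK.eventually_ge_atTop 1] with n hn
  have hKpos : (0 : ℝ) < K n := by exact_mod_cast hn
  rw [Real.norm_eq_abs, abs_mul, abs_of_pos (by positivity), one_div, inv_mul_le_iff₀ hKpos]
  calc _ ≤ ∑ i, (∑ j ∈ Finset.univ.erase i, P n i j * p n j) ^ 2 * |B| := by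
        refine (Finset.abs_sum_le_sum_abs _ _).trans (Finset.sum_le_sum fun i _ => ?_)
        rw [abs_mul, abs_of_nonneg (sq_nonneg _)]
        exact mul_le_mul_of_nonneg_left ((hx n i).trans (le_abs_self B)) (sq_nonneg _)
    _ = |B| * ∑ i, (∑ j ∈ Finset.univ.erase i, P n i j * p n j) ^ 2 := by
        rw [← Finset.sum_mul, mul_comm]
    _ ≤ |B| * (4 * ((K n : ℝ) * ((∑ i, p n i ^ 2) / (K n : ℝ)))) :=
        mul_le_mul_of_nonneg_left (sum_sq_offDiag_le hP htr p n) (abs_nonneg _)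
    _ = _ := by ring

omit htr in
theorem tendsto_sum_sq_entry_mul {x : ∀ n, Fin n → ℝ} (hx : ∀ n i, |x n i| ≤ B)
    (hp : Tendsto (fun n => (∑ i, p n i ^ 2) / (K n : ℝ)) atTop (𝓝 0)) :
    Tendsto (fun n => 1 / (K n : ℝ) *
      ∑ i, ∑ j ∈ Finset.univ.erase i, P n i j ^ 2 * (p n i ^ 2 * x n j)) atTop (𝓝 0) := by
  refine squeeze_zero_norm' (a := fun n => |B| * ((∑ i, p n i ^ 2) / (K n : ℝ))) ?_
    (by simpa using hp.const_mul |B|)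
  filter_upwards [hK.eventually_ge_atTop 1] with n hn
  have hKpos : (0 : ℝ) < K n := by exact_mod_cast hn
  rw [Real.norm_eq_abs, abs_mul, abs_of_pos (by positivity), one_div, inv_mul_le_iff₀ hKpos]
  calc |∑ i, ∑ j ∈ Finset.univ.erase i, P n i j ^ 2 * (p n i ^ 2 * x n j)|
      ≤ ∑ i, ∑ j ∈ Finset.univ.erase i, P n i j ^ 2 * (p n i ^ 2 * |B|) := by
        refine (Finset.abs_sum_le_sum_abs _ _).trans (Finset.sum_le_sum fun i _ =>
          (Finset.abs_sum_le_sum_abs _ _).trans (Finset.sum_le_sum fun j _ => ?_))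
        rw [abs_mul, abs_mul, abs_of_nonneg (sq_nonneg _), abs_of_nonneg (sq_nonneg _)]
        exact mul_le_mul_of_nonneg_left (mul_le_mul_of_nonneg_left
          ((hx n j).trans (le_abs_self B)) (sq_nonneg _)) (sq_nonneg _)
    _ ≤ ∑ i, p n i ^ 2 * |B| := by
        refine Finset.sum_le_sum fun i _ => ?_
        rw [← Finset.sum_mul]
        refine mul_le_of_le_one_left (by positivity) ?_
        exact (Finset.sum_le_sum_of_subset_of_nonneg (Finset.subset_univ _)
          fun _ _ _ => sq_nonneg _).trans (((hP n).sum_sq_row i).trans_le ((hP n).diag_le_one i))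
    _ = _ := by rw [← Finset.sum_mul]; field_simp

end

include hK hP htr hind hζ hB

/-- All three forms of `IsSymmIdem.bilinear_decomp` have second moment O(K), against the
normalization K². -/
theorem isLittleOProb_bilinear (ha : ∀ n, SqBounded (μ n) (ζ n) B (a n))
    (hb : ∀ n, SqBounded (μ n) (ζ n) B (b n)) :
    IsLittleOProb μ fun n ω =>
      1 / (K n : ℝ) * (∑ i, ∑ j ∈ Finset.univ.erase i,
          P n i j ^ 2 * (a n i (ζ n i ω) * b n j (ζ n j ω))
        - ∑ i, ∑ j ∈ Finset.univ.erase i,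
          P n i j ^ 2 * (meanOf (μ n) (ζ n) (a n) i * meanOf (μ n) (ζ n) (b n) j)) := by
  have hprob : ∀ n, IsProbabilityMeasure (μ n) := fun n => (hind n).isProbabilityMeasure
  have h1 : IsLittleOProb μ fun n ω => 1 / (K n : ℝ) *
      ∑ i, ∑ j ∈ Finset.univ.erase i, P n i j ^ 2 *
        (centered (μ n) (ζ n) (a n) i (ζ n i ω) * centered (μ n) (ζ n) (b n) j (ζ n j ω)) := by
    refine IsLittleOProb.of_secondMomentLe (fun n => ?_)
      (tendsto_const_mul_inv_natCast hK (4 * B ^ 2))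
    rw [natCast_sq_mul_inv, ← htr n]
    exact (secondMomentLe_bilinear (hind n) (hζ n) hB (ha n).center (hb n).center _).mono
      (mul_le_mul_of_nonneg_left (hP n).sum_offDiag_pow_four_le (by positivity))
  have h2 : ∀ {a b : ∀ n, Fin n → S → ℝ}, (∀ n, SqBounded (μ n) (ζ n) B (a n)) →
      (∀ n, SqBounded (μ n) (ζ n) B (b n)) → IsLittleOProb μ fun n ω => 1 / (K n : ℝ) *
      ∑ i, (∑ j ∈ Finset.univ.erase i, P n i j ^ 2 * meanOf (μ n) (ζ n) (b n) j) *
        centered (μ n) (ζ n) (a n) i (ζ n i ω) := by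
    intro a b ha hb
    refine IsLittleOProb.of_secondMomentLe (fun n => ?_)
      (tendsto_const_mul_inv_natCast hK (B * B))
    rw [natCast_sq_mul_inv, ← htr n, mul_assoc]
    exact (secondMomentLe_linear (hind n) (hζ n) hB (ha n).center _).mono
      (mul_le_mul_of_nonneg_left ((hP n).sum_sq_weighted_row_le (hb n).meanOf_sq_le)
        (by positivity))
  convert h1.add ((h2 ha hb).add (h2 hb ha)) using 3 with n ω
  rw [(hP n).bilinear_decomp, mul_add, mul_add]
  rfl

/-- With s = ‖p‖²/K → 0, the deterministic om term is O(s) after normalization; the forms whose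
weights contain om have second moments O(K² s²) or O(K s), and the pairs j ≠ k give O(K). Only the
diagonal j = k has a nonnegligible center. -/
theorem isLittleOProb_jackknife (hc : ∀ n, SqBounded (μ n) (ζ n) B (c n))
    (hv : ∀ n, CenteredSqBounded (μ n) (ζ n) B (v n))
    (hv2 : ∀ n, SqBounded (μ n) (ζ n) B fun i x => v n i x ^ 2)
    (hp : Tendsto (fun n => (∑ i, p n i ^ 2) / (K n : ℝ)) atTop (𝓝 0)) :
    IsLittleOProb μ fun n ω =>
      1 / (K n : ℝ) * (∑ i, (∑ j ∈ Finset.univ.erase i,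
          P n i j * (p n j + v n j (ζ n j ω))) ^ 2 * c n i (ζ n i ω)
        - ∑ i, ∑ j ∈ Finset.univ.erase i, P n i j ^ 2 *
          (meanOf (μ n) (ζ n) (c n) i * meanOf (μ n) (ζ n) (fun i x => v n i x ^ 2) j)) := by
  have hprob : ∀ n, IsProbabilityMeasure (μ n) := fun n => (hind n).isProbabilityMeasure
  have hB0 : 0 ≤ B := zero_le_one.trans hB
  set s : ℕ → ℝ := fun n => (∑ i, p n i ^ 2) / (K n : ℝ) with hs
  let om : ∀ n, Fin n → ℝ := fun n i => ∑ j ∈ Finset.univ.erase i, P n i j * p n j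
  have hom' : ∀ n, ∑ i, om n i ^ 2 ≤ 4 * (K n * s n) := sum_sq_offDiag_le hP htr p
  have hs0 : ∀ n, 0 ≤ s n := fun n =>
    div_nonneg (Finset.sum_nonneg fun _ _ => sq_nonneg _) (Nat.cast_nonneg _)
  have hsK : Tendsto (fun n => s n * (K n : ℝ)⁻¹) atTop (𝓝 0) := by
    simpa using hp.mul (tendsto_const_mul_inv_natCast hK 1)
  have hmean : ∀ n i, |meanOf (μ n) (ζ n) (c n) i| ≤ B := by
    intro n i
    refine abs_le_of_sq_le_sq (((hc n).meanOf_sq_le i).trans ?_) hB0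
    nlinarith
  have t1 : IsLittleOProb μ fun n _ =>
      1 / (K n : ℝ) * ∑ i, om n i ^ 2 * meanOf (μ n) (ζ n) (c n) i := by
    exact IsLittleOProb.of_tendsto_zero (tendsto_sum_sq_offDiag_mul hK hP htr hmean hp)
  have t2 : IsLittleOProb μ fun n ω => 1 / (K n : ℝ) *
      ∑ i, om n i ^ 2 * centered (μ n) (ζ n) (c n) i (ζ n i ω) := by
    -- The weights are om_i², and ∑ om_i⁴ ≤ (∑ om_i²)² ≤ (4 K s)².
    refine IsLittleOProb.of_secondMomentLe (d := fun n => B * (16 * s n ^ 2)) (fun n => ?_)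
      (by simpa using ((hp.pow 2).const_mul 16).const_mul B)
    refine (secondMomentLe_linear (hind n) (hζ n) hB (hc n).center _).mono ?_
    calc B * ∑ i, (om n i ^ 2) ^ 2 ≤ B * (∑ i, om n i ^ 2) ^ 2 :=
          mul_le_mul_of_nonneg_left
            (Finset.sum_sq_le_sq_sum_of_nonneg fun _ _ => sq_nonneg _) hB0
      _ ≤ B * (4 * (K n * s n)) ^ 2 := by
          refine mul_le_mul_of_nonneg_left (pow_le_pow_left₀ ?_ (hom' n) 2) hB0
          positivity
      _ = _ := by ring
  have t3 : IsLittleOProb μ fun n ω => 1 / (K n : ℝ) *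
      ∑ i, ∑ j ∈ Finset.univ.erase i, om n i * P n i j *
        (centered (μ n) (ζ n) (c n) i (ζ n i ω) * v n j (ζ n j ω)) := by
    refine IsLittleOProb.of_secondMomentLe (d := fun n => 16 * B ^ 2 * (s n * (K n : ℝ)⁻¹))
      (fun n => ?_) (by simpa using hsK.const_mul (16 * B ^ 2))
    refine (secondMomentLe_bilinear (hind n) (hζ n) hB (hc n).center (hv n) _).mono ?_
    have h : ∑ i, ∑ j ∈ Finset.univ.erase i, (om n i * P n i j) ^ 2 ≤ ∑ i, om n i ^ 2 := by
      refine Finset.sum_le_sum fun i _ => ?_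
      calc _ ≤ ∑ j, (om n i * P n i j) ^ 2 :=
            Finset.sum_le_sum_of_subset_of_nonneg (Finset.subset_univ _) fun _ _ _ => sq_nonneg _
        _ = om n i ^ 2 * P n i i := by
            rw [← (hP n).sum_sq_row, Finset.mul_sum]
            exact Finset.sum_congr rfl fun _ _ => by ring
        _ ≤ _ := mul_le_of_le_one_right (sq_nonneg _) ((hP n).diag_le_one i)
    calc _ ≤ 4 * B ^ 2 * (4 * (K n * s n)) :=
          mul_le_mul_of_nonneg_left (h.trans (hom' n)) (by positivity)
      _ = 16 * B ^ 2 * ((K n : ℝ) ^ 2 * (s n * (K n : ℝ)⁻¹)) := by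
          rw [natCast_sq_mul_inv]; ring
      _ = _ := by ring
  have t4 : IsLittleOProb μ fun n ω => 1 / (K n : ℝ) *
      ∑ i, (∑ j ∈ Finset.univ.erase i, P n i j * (om n j * meanOf (μ n) (ζ n) (c n) j)) *
        v n i (ζ n i ω) := by
    refine IsLittleOProb.of_secondMomentLe (d := fun n => 16 * B ^ 2 * (s n * (K n : ℝ)⁻¹))
      (fun n => ?_) (by simpa using hsK.const_mul (16 * B ^ 2))
    refine (secondMomentLe_linear (hind n) (hζ n) hB (hv n) _).mono ?_
    have h : ∑ i, (om n i * meanOf (μ n) (ζ n) (c n) i) ^ 2 ≤ B * ∑ i, om n i ^ 2 := by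
      rw [Finset.mul_sum]
      refine Finset.sum_le_sum fun i _ => ?_
      rw [mul_pow, mul_comm]
      exact mul_le_mul_of_nonneg_right ((hc n).meanOf_sq_le i) (sq_nonneg _)
    calc _ ≤ B * (4 * (B * (4 * (K n * s n)))) := by
          refine mul_le_mul_of_nonneg_left (((hP n).sum_sq_offDiag_apply_le _).trans ?_) hB0
          refine mul_le_mul_of_nonneg_left (h.trans ?_) (by norm_num)
          exact mul_le_mul_of_nonneg_left (hom' n) hB0
      _ = 16 * B ^ 2 * ((K n : ℝ) ^ 2 * (s n * (K n : ℝ)⁻¹)) := by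
          rw [natCast_sq_mul_inv]; ring
      _ = _ := by ring
  have t6 : IsLittleOProb μ fun n ω => 1 / (K n : ℝ) *
      ∑ i, ∑ j ∈ Finset.univ.erase i, ∑ k ∈ (Finset.univ.erase i).erase j, P n i j * P n i k *
        (centered (μ n) (ζ n) (c n) i (ζ n i ω) * v n j (ζ n j ω) * v n k (ζ n k ω)) := by
    refine IsLittleOProb.of_secondMomentLe (fun n => ?_)
      (tendsto_const_mul_inv_natCast hK (27 * B ^ 3))
    rw [natCast_sq_mul_inv, ← htr n]
    exact (secondMomentLe_trilinear (hind n) (hζ n) hB (hc n).center (hv n) (hv n)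
      fun i j k => P n i j * P n i k).mono
      (mul_le_mul_of_nonneg_left (hP n).sum_triple_sq_le (by positivity))
  have t7 : IsLittleOProb μ fun n ω => 1 / (K n : ℝ) *
      ∑ j, ∑ k ∈ Finset.univ.erase j, (∑ i ∈ (Finset.univ.erase j).erase k,
        P n i j * P n i k * meanOf (μ n) (ζ n) (c n) i) * (v n j (ζ n j ω) * v n k (ζ n k ω)) := by
    refine IsLittleOProb.of_secondMomentLe (fun n => ?_)
      (tendsto_const_mul_inv_natCast hK (4 * B ^ 2 * (9 * B)))
    rw [natCast_sq_mul_inv, ← htr n, mul_assoc]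
    exact (secondMomentLe_bilinear (hind n) (hζ n) hB (hv n) (hv n) _).mono
      (mul_le_mul_of_nonneg_left ((hP n).sum_sq_offDiag_sandwich_le (hc n).meanOf_sq_le)
        (by positivity))
  have t5 := isLittleOProb_bilinear hK hP htr hind hζ hB hc hv2
  convert t1.add (t2.add ((t3.const_mul 2).add ((t4.const_mul 2).add (t5.add (t6.add t7)))))
    using 3 with n ω
  rw [(hP n).jackknife_decomp (p n) (fun j => v n j (ζ n j ω)) (fun i => c n i (ζ n i ω))
    (meanOf (μ n) (ζ n) (c n))]
  simp only [centered, om]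
  ring

end Forms

/-! ### The variance estimators in terms of quadratic and jackknife forms -/

namespace IVModel

section Algebra

variable {n k : ℕ} {Ω : Type*} (M : IVModel n k Ω)

/-- The form `K⁻¹ ∑_i ∑_{j ≠ i} P_ij² x_i y_j`. -/
def form (x y : Fin n → ℝ) : ℝ := 1 / (k : ℝ) * M.offSum fun i j => x i * y j

/-- The jackknife form `K⁻¹ ∑_i (∑_{j ≠ i} P_ij X_j)² c_i`. -/
def jack (X c : Fin n → ℝ) : ℝ :=
  1 / (k : ℝ) * ∑ i, (∑ j ∈ Finset.univ.erase i, M.P i j * X j) ^ 2 * c i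

/-- `e_i²`. -/
def eSq (ω : Ω) (i : Fin n) : ℝ := M.e i ω ^ 2

/-- `X_i e_i`. -/
def Xe (ω : Ω) (i : Fin n) : ℝ := M.X i ω * M.e i ω

/-- `X_i²`. -/
def XSq (ω : Ω) (i : Fin n) : ℝ := M.X i ω ^ 2

theorem form_symm (h : IsSymmIdem M.P) (x y : Fin n → ℝ) : M.form x y = M.form y x := by
  unfold form offSum
  rw [sum_erase_comm]
  congr 1
  exact Finset.sum_congr rfl fun i _ => Finset.sum_congr rfl fun j _ => by
    rw [h.symm i j]; ring

theorem res_eq (b : ℝ) (i : Fin n) (ω : Ω) :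
    M.res b i ω = M.e i ω + (M.beta - b) * M.X i ω := by
  unfold res Y; ring

section

variable (h : IsSymmIdem M.P) (b : ℝ) (ω : Ω)
include h

/-- Substitute e_i(β₀) = e_i + Δ X_i and collect powers of Δ; symmetry of the form merges mixed
terms. The coefficients no longer depend on β₀. The other components are treated alike. -/
theorem est_Phi1 : (M.est b ω).Phi1 = 2 * M.form (M.eSq ω) (M.eSq ω)
    + (M.beta - b) * (8 * M.form (M.eSq ω) (M.Xe ω))
    + (M.beta - b) ^ 2 * (4 * M.form (M.eSq ω) (M.XSq ω) + 8 * M.form (M.Xe ω) (M.Xe ω))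
    + (M.beta - b) ^ 3 * (8 * M.form (M.Xe ω) (M.XSq ω))
    + (M.beta - b) ^ 4 * (2 * M.form (M.XSq ω) (M.XSq ω)) := by
  have e1 := M.form_symm h (M.eSq ω) (M.Xe ω)
  have e2 := M.form_symm h (M.eSq ω) (M.XSq ω)
  have e3 := M.form_symm h (M.Xe ω) (M.XSq ω)
  have : (M.est b ω).Phi1 = 2 * M.form (M.eSq ω) (M.eSq ω)
      + (M.beta - b) * (4 * M.form (M.eSq ω) (M.Xe ω) + 4 * M.form (M.Xe ω) (M.eSq ω))
      + (M.beta - b) ^ 2 * (2 * M.form (M.eSq ω) (M.XSq ω) + 2 * M.form (M.XSq ω) (M.eSq ω)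
        + 8 * M.form (M.Xe ω) (M.Xe ω))
      + (M.beta - b) ^ 3 * (4 * M.form (M.Xe ω) (M.XSq ω) + 4 * M.form (M.XSq ω) (M.Xe ω))
      + (M.beta - b) ^ 4 * (2 * M.form (M.XSq ω) (M.XSq ω)) := by
    simp only [est, form, offSum, eSq, Xe, XSq, Finset.mul_sum, ← Finset.sum_add_distrib, res_eq]
    exact Finset.sum_congr rfl fun i _ => Finset.sum_congr rfl fun j _ => by ring
  rw [this, ← e1, ← e2, ← e3]; ring

theorem est_Phi12 : (M.est b ω).Phi12 = 2 * M.form (M.eSq ω) (M.Xe ω)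
    + (M.beta - b) * (4 * M.form (M.Xe ω) (M.Xe ω) + 2 * M.form (M.eSq ω) (M.XSq ω))
    + (M.beta - b) ^ 2 * (6 * M.form (M.Xe ω) (M.XSq ω))
    + (M.beta - b) ^ 3 * (2 * M.form (M.XSq ω) (M.XSq ω)) := by
  have e1 := M.form_symm h (M.eSq ω) (M.Xe ω)
  have e2 := M.form_symm h (M.eSq ω) (M.XSq ω)
  have e3 := M.form_symm h (M.Xe ω) (M.XSq ω)
  have : (M.est b ω).Phi12 = M.form (M.eSq ω) (M.Xe ω) + M.form (M.Xe ω) (M.eSq ω)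
    + (M.beta - b) * (4 * M.form (M.Xe ω) (M.Xe ω) + M.form (M.eSq ω) (M.XSq ω)
      + M.form (M.XSq ω) (M.eSq ω))
    + (M.beta - b) ^ 2 * (3 * M.form (M.Xe ω) (M.XSq ω) + 3 * M.form (M.XSq ω) (M.Xe ω))
    + (M.beta - b) ^ 3 * (2 * M.form (M.XSq ω) (M.XSq ω)) := by
    simp only [est, form, offSum, eSq, Xe, XSq, Finset.mul_sum, ← Finset.sum_add_distrib, res_eq]
    exact Finset.sum_congr rfl fun i _ => Finset.sum_congr rfl fun j _ => by ring
  rw [this, ← e1, ← e2, ← e3]; ring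

theorem est_Phi13 : (M.est b ω).Phi13 = 2 * M.form (M.Xe ω) (M.Xe ω)
    + (M.beta - b) * (4 * M.form (M.Xe ω) (M.XSq ω))
    + (M.beta - b) ^ 2 * (2 * M.form (M.XSq ω) (M.XSq ω)) := by
  have e3 := M.form_symm h (M.Xe ω) (M.XSq ω)
  have : (M.est b ω).Phi13 = 2 * M.form (M.Xe ω) (M.Xe ω)
    + (M.beta - b) * (2 * M.form (M.Xe ω) (M.XSq ω) + 2 * M.form (M.XSq ω) (M.Xe ω))
    + (M.beta - b) ^ 2 * (2 * M.form (M.XSq ω) (M.XSq ω)) := by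
    simp only [est, form, offSum, Xe, XSq, Finset.mul_sum, ← Finset.sum_add_distrib, res_eq]
    exact Finset.sum_congr rfl fun i _ => Finset.sum_congr rfl fun j _ => by ring
  rw [this, ← e3]; ring

theorem est_Psi : (M.est b ω).Psi =
    (M.jack (fun i => M.X i ω) (M.eSq ω) + M.form (M.Xe ω) (M.Xe ω))
    + (M.beta - b) * (2 * M.jack (fun i => M.X i ω) (M.Xe ω) + 2 * M.form (M.Xe ω) (M.XSq ω))
    + (M.beta - b) ^ 2 * (M.jack (fun i => M.X i ω) (M.XSq ω)
      + M.form (M.XSq ω) (M.XSq ω)) := by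
  have e := M.est_Phi13 h b ω
  have : (M.est b ω).Psi = M.jack (fun i => M.X i ω) (M.eSq ω)
      + (M.beta - b) * (2 * M.jack (fun i => M.X i ω) (M.Xe ω))
      + (M.beta - b) ^ 2 * M.jack (fun i => M.X i ω) (M.XSq ω) + (M.est b ω).Phi13 / 2 := by
    -- The off-diagonal part is half of the estimator of Φ₁₃, so only the jackknife part needs
    -- expanding.
    have : (M.est b ω).Psi = M.jack (fun i => M.X i ω) (fun i => M.res b i ω ^ 2)
        + (M.est b ω).Phi13 / 2 := by simp only [est, jack]; ring
    rw [this]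
    congr 1
    simp only [jack, eSq, Xe, XSq, Finset.mul_sum, ← Finset.sum_add_distrib, res_eq]
    exact Finset.sum_congr rfl fun i _ => by ring
  rw [this, e]; ring

theorem est_tau : (M.est b ω).tau =
    (M.jack (fun i => M.X i ω) (M.Xe ω) + M.form (M.Xe ω) (M.XSq ω))
    + (M.beta - b) * (M.jack (fun i => M.X i ω) (M.XSq ω) + M.form (M.XSq ω) (M.XSq ω)) := by
  rw [M.form_symm h (M.Xe ω) (M.XSq ω)]
  have : ∀ a b c d D : ℝ, a + b + D * (c + d) = (a + D * c) + (b + D * d) := by intros; ring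
  rw [this]
  simp only [est]
  congr 1
  · simp only [jack, Xe, XSq, Finset.mul_sum, ← Finset.sum_add_distrib, res_eq]
    exact Finset.sum_congr rfl fun i _ => by ring
  · simp only [form, offSum, Xe, XSq, Finset.mul_sum, ← Finset.sum_add_distrib, res_eq]
    exact Finset.sum_congr rfl fun i _ => Finset.sum_congr rfl fun j _ => by ring

end

theorem est_Upsilon (b : ℝ) (ω : Ω) :
    (M.est b ω).Upsilon = 2 * M.form (M.XSq ω) (M.XSq ω) := by
  simp only [est, form, XSq]; ring

variable [MeasurableSpace Ω] (μ : Measure Ω)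

theorem pop_Phi1 : (M.pop μ).Phi1 = 2 * M.form (M.sigmaSq μ) (M.sigmaSq μ) := by
  simp only [pop, form]; ring

theorem pop_Phi12 (h : IsSymmIdem M.P) :
    (M.pop μ).Phi12 = 2 * M.form (M.sigmaSq μ) (M.gam μ) := by
  have e := M.form_symm h (M.sigmaSq μ) (M.gam μ)
  have : (M.pop μ).Phi12 = M.form (M.sigmaSq μ) (M.gam μ) + M.form (M.gam μ) (M.sigmaSq μ) := by
    simp only [pop, form, offSum, Finset.mul_sum, ← Finset.sum_add_distrib]
    exact Finset.sum_congr rfl fun i _ => Finset.sum_congr rfl fun j _ => by ring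
  rw [this, ← e]; ring

theorem pop_Phi13 : (M.pop μ).Phi13 = 2 * M.form (M.gam μ) (M.gam μ) := by
  simp only [pop, form]; ring

theorem pop_Psi (h : IsSymmIdem M.P) : (M.pop μ).Psi = M.form (M.sigmaSq μ) (M.etaSq μ)
    + M.form (M.gam μ) (M.gam μ) + M.jack M.Pi (M.sigmaSq μ) := by
  rw [M.form_symm h (M.sigmaSq μ) (M.etaSq μ)]
  simp only [pop, jack, om]
  congr 1
  simp only [form, offSum, Finset.mul_sum, ← Finset.sum_add_distrib]
  exact Finset.sum_congr rfl fun i _ => Finset.sum_congr rfl fun j _ => by ring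

theorem pop_tau (h : IsSymmIdem M.P) : (M.pop μ).tau = 2 * M.form (M.gam μ) (M.etaSq μ)
    + 2 * M.jack M.Pi (M.gam μ) := by
  rw [M.form_symm h (M.gam μ) (M.etaSq μ)]
  simp only [pop, jack, om, form]
  ring

theorem pop_Upsilon : (M.pop μ).Upsilon = 2 * M.form (M.etaSq μ) (M.etaSq μ)
    + 4 * M.jack M.Pi (M.etaSq μ) := by
  simp only [pop, jack, om, form]
  ring

end Algebra

end IVModel

/-! ### Consistency of the component estimators -/

theorem SqBounded.of_sixth_moment {ι Ω : Type*} [MeasurableSpace Ω] {μ : Measure Ω}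
    [IsProbabilityMeasure μ] {e V : ι → Ω → ℝ} (he : ∀ i, Measurable (e i))
    (hV : ∀ i, Measurable (V i)) {A D B : ℝ} (hA : 0 ≤ A)
    (hie : ∀ i, Integrable (fun ω => e i ω ^ 6) μ ∧ ∫ ω, e i ω ^ 6 ∂μ ≤ D)
    (hiV : ∀ i, Integrable (fun ω => V i ω ^ 6) μ ∧ ∫ ω, V i ω ^ 6 ∂μ ≤ D)
    (hB : A * (1 + D + D) ≤ B) {a : ι → ℝ × ℝ → ℝ} (ha : ∀ i, Measurable (a i))
    (hle : ∀ i x, a i x ^ 2 ≤ A * (1 + x.1 ^ 6 + x.2 ^ 6)) :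
    SqBounded μ (fun i ω => (e i ω, V i ω)) B a := by
  have hint : ∀ i, Integrable (fun ω => A * (1 + e i ω ^ 6 + V i ω ^ 6)) μ := fun i =>
    (((integrable_const 1).add (hie i).1).add (hiV i).1).const_mul A
  have hmeas : ∀ i, Measurable fun ω => a i (e i ω, V i ω) :=
    fun i => (ha i).comp ((he i).prodMk (hV i))
  have hsq : ∀ i, Integrable (fun ω => a i (e i ω, V i ω) ^ 2) μ := fun i =>
    (hint i).mono' ((hmeas i).pow_const 2).aestronglyMeasurable
      (ae_of_all _ fun ω => by
        rw [Real.norm_eq_abs, abs_of_nonneg (sq_nonneg _)]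
        exact hle i (e i ω, V i ω))
  refine ⟨ha, fun i => (memLp_two_iff_integrable_sq (hmeas i).aestronglyMeasurable).2 (hsq i),
    fun i => ?_⟩
  calc _ ≤ ∫ ω, A * (1 + e i ω ^ 6 + V i ω ^ 6) ∂μ :=
        integral_mono (hsq i) (hint i) fun ω => hle i (e i ω, V i ω)
    _ = A * (1 + ∫ ω, e i ω ^ 6 ∂μ + ∫ ω, V i ω ^ 6 ∂μ) := by
        have h : Integrable (fun ω => 1 + e i ω ^ 6) μ := (integrable_const 1).add (hie i).1
        rw [integral_const_mul, integral_add h (hiV i).1,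
          integral_add (integrable_const 1) (hie i).1]
        simp
    _ ≤ A * (1 + D + D) := by
        have h1 := (hie i).2
        have h2 := (hiV i).2
        gcongr
    _ ≤ B := hB

theorem pow_four_le_one_add_pow_six (x : ℝ) : x ^ 4 ≤ 1 + x ^ 6 := by
  nlinarith [sq_nonneg (x ^ 2 - 1), sq_nonneg (x * (x ^ 2 - 1)), sq_nonneg x]

theorem sq_le_one_add_pow_six (x : ℝ) : x ^ 2 ≤ 1 + x ^ 6 := by
  nlinarith [sq_nonneg (x ^ 2 - 1), sq_nonneg (x * (x ^ 2 - 1)), sq_nonneg x]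

theorem add_pow_four_le {p C x : ℝ} (hp : |p| ≤ C) :
    (p + x) ^ 4 ≤ 8 * C ^ 4 + 8 * (1 + x ^ 6) := by
  have h1 : (p + x) ^ 4 ≤ 8 * p ^ 4 + 8 * x ^ 4 := by
    have h := sq_nonneg (p - x)
    have h2 : (p + x) ^ 2 ≤ 2 * p ^ 2 + 2 * x ^ 2 := by linarith
    calc (p + x) ^ 4 = ((p + x) ^ 2) ^ 2 := by ring
      _ ≤ (2 * p ^ 2 + 2 * x ^ 2) ^ 2 := pow_le_pow_left₀ (sq_nonneg _) h2 2
      _ ≤ _ := by nlinarith [sq_nonneg (p ^ 2 - x ^ 2)]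
  have h2 : p ^ 4 ≤ C ^ 4 := by
    rw [← (by decide : Even 4).pow_abs p]
    exact pow_le_pow_left₀ (abs_nonneg _) hp 4
  linarith [pow_four_le_one_add_pow_six x]

section Consistency

variable {K : ℕ → ℕ} {Ω : ℕ → Type*} [∀ n, MeasurableSpace (Ω n)]
  {μ : ∀ n, Measure (Ω n)} [∀ n, IsProbabilityMeasure (μ n)]
  {M : ∀ n, IVModel n (K n) (Ω n)} {L : VarComp}

/-- The forms at the true parameter converge to the limits of the variance components. -/
structure FormsConsistent (μ : ∀ n, Measure (Ω n)) (M : ∀ n, IVModel n (K n) (Ω n))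
    (L : VarComp) : Prop where
  ee : IsLittleOProb μ fun n ω => (M n).form ((M n).eSq ω) ((M n).eSq ω) - L.Phi1 / 2
  eg : IsLittleOProb μ fun n ω => (M n).form ((M n).eSq ω) ((M n).Xe ω) - L.Phi12 / 2
  gg : IsLittleOProb μ fun n ω => (M n).form ((M n).Xe ω) ((M n).Xe ω) - L.Phi13 / 2
  ex : IsLittleOProb μ fun n ω =>
    (M n).form ((M n).eSq ω) ((M n).XSq ω) - (L.Psi - L.Phi13 / 2)
  gx : IsLittleOProb μ fun n ω => (M n).form ((M n).Xe ω) ((M n).XSq ω) - L.tau / 2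
  xx : IsLittleOProb μ fun n ω => (M n).form ((M n).XSq ω) ((M n).XSq ω) - L.Upsilon / 2
  je : IsLittleOProb μ fun n ω =>
    (M n).jack (fun i => (M n).X i ω) ((M n).eSq ω) - (L.Psi - L.Phi13 / 2)
  jg : IsLittleOProb μ fun n ω => (M n).jack (fun i => (M n).X i ω) ((M n).Xe ω) - L.tau / 2
  jx : IsLittleOProb μ fun n ω => (M n).jack (fun i => (M n).X i ω) ((M n).XSq ω) - L.Upsilon / 2

/-- The jackknife form of c and the quadratic form of c and X² share a limit, that of the form of E
c and η². For c = e² it is Ψ - Φ₁₃/2: the γγ part of Ψ tends to Φ₁₃/2 and its ω part to 0. -/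
theorem formsConsistent (hP : ProjectionDesign μ M) (hM : MomentConditions μ M)
    (hL : IsVarLimit μ M L) : FormsConsistent μ M L := by
  have hK := hP.K_tendsto
  have hI : ∀ n, IsSymmIdem (M n).P := fun n => (M n).isSymmIdem_P (hP.rank_P n)
  have htr : ∀ n, (M n).P.trace = K n := fun n => (M n).trace_P (hP.rank_P n)
  have hind := hP.indep
  have hζ : ∀ n i, Measurable fun ω => ((M n).e i ω, (M n).V i ω) :=
    fun n i => (hP.meas_e n i).prodMk (hP.meas_V n i)
  obtain ⟨C, hC⟩ := hM.bdd_Pi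
  obtain ⟨D₁, hD₁⟩ := hM.sixth_e
  obtain ⟨D₂, hD₂⟩ := hM.sixth_V
  set D := max (max D₁ D₂) 0
  have hD0 : 0 ≤ D := le_max_right _ _
  have hDe : ∀ n i, Integrable (fun ω => (M n).e i ω ^ 6) (μ n) ∧
      ∫ ω, (M n).e i ω ^ 6 ∂(μ n) ≤ D := fun n i =>
    ⟨(hD₁ n i).1, (hD₁ n i).2.trans ((le_max_left _ _).trans (le_max_left _ _))⟩
  have hDV : ∀ n i, Integrable (fun ω => (M n).V i ω ^ 6) (μ n) ∧
      ∫ ω, (M n).V i ω ^ 6 ∂(μ n) ≤ D := fun n i =>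
    ⟨(hD₂ n i).1, (hD₂ n i).2.trans ((le_max_right _ _).trans (le_max_left _ _))⟩
  -- Chosen so that `add_pow_four_le` yields (Π_i + x)⁴ ≤ A (1 + x⁶). With D ≥ 0 it also makes B ≥
  -- 8.
  set A := 8 * C ^ 4 + 8 with hAdef
  have hC4 : 0 ≤ C ^ 4 := by positivity
  have hA8 : 8 ≤ A := by linarith
  have hA : 0 ≤ A := by linarith
  set B := A * (1 + D + D) with hBdef
  have hB1 : 1 ≤ B := by nlinarith
  have hB0 : 0 ≤ B := zero_le_one.trans hB1
  let ζ : ∀ n, Fin n → Ω n → ℝ × ℝ := fun n i ω => ((M n).e i ω, (M n).V i ω)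
  have hbase : ∀ n {a : Fin n → ℝ × ℝ → ℝ}, (∀ i, Measurable (a i)) →
      (∀ i x, a i x ^ 2 ≤ A * (1 + x.1 ^ 6 + x.2 ^ 6)) → SqBounded (μ n) (ζ n) B a :=
    fun n a ha hle => SqBounded.of_sixth_moment (hP.meas_e n) (hP.meas_V n) hA (hDe n) (hDV n)
      le_rfl ha hle
  have hle1 : ∀ y z : ℝ, 0 ≤ z → y ≤ 1 + z → ∀ w : ℝ, 0 ≤ w → y ≤ A * (1 + z + w) := by
    intro y z hz hy w hw; nlinarith
  have p6 : ∀ x : ℝ, 0 ≤ x ^ 6 := fun x => by positivity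
  let fe : ∀ n, Fin n → ℝ × ℝ → ℝ := fun n i x => x.1 ^ 2
  let fg : ∀ n, Fin n → ℝ × ℝ → ℝ := fun n i x => ((M n).Pi i + x.2) * x.1
  let fx : ∀ n, Fin n → ℝ × ℝ → ℝ := fun n i x => ((M n).Pi i + x.2) ^ 2
  let fv : ∀ n, Fin n → ℝ × ℝ → ℝ := fun n i x => x.2
  have hX4 : ∀ n i (x : ℝ), ((M n).Pi i + x) ^ 4 ≤ A * (1 + x ^ 6) := by
    intro n i x
    have := add_pow_four_le (x := x) (hC n i)
    nlinarith [p6 x]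
  have he : ∀ n, SqBounded (μ n) (ζ n) B (fe n) := fun n =>
    hbase n (fun i => measurable_fst.pow_const 2) fun i x => by
      refine hle1 _ _ (p6 _) ?_ _ (p6 _)
      calc (x.1 ^ 2) ^ 2 = x.1 ^ 4 := by ring
        _ ≤ _ := pow_four_le_one_add_pow_six _
  have hg : ∀ n, SqBounded (μ n) (ζ n) B (fg n) := fun n =>
    hbase n (fun i => (measurable_snd.const_add _).mul measurable_fst) fun i x => by
      have h1 := hX4 n i x.2
      have h2 := pow_four_le_one_add_pow_six x.1
      calc _ = ((M n).Pi i + x.2) ^ 2 * x.1 ^ 2 := by simp only [fg]; ring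
        _ ≤ (((M n).Pi i + x.2) ^ 4 + x.1 ^ 4) / 2 := by
            nlinarith [sq_nonneg (((M n).Pi i + x.2) ^ 2 - x.1 ^ 2)]
        _ ≤ (A * (1 + x.2 ^ 6) + (1 + x.1 ^ 6)) / 2 := by linarith
        _ ≤ _ := by nlinarith [p6 x.1, p6 x.2]
  have hx : ∀ n, SqBounded (μ n) (ζ n) B (fx n) := fun n =>
    hbase n (fun i => (measurable_snd.const_add _).pow_const 2) fun i x => by
      calc _ = ((M n).Pi i + x.2) ^ 4 := by simp only [fx]; ring
        _ ≤ A * (1 + x.2 ^ 6) := hX4 n i x.2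
        _ ≤ _ := by nlinarith [p6 x.1, p6 x.2]
  have hv : ∀ n, SqBounded (μ n) (ζ n) B (fv n) := fun n =>
    hbase n (fun i => measurable_snd) fun i x => by
      have := hle1 _ _ (p6 x.2) (sq_le_one_add_pow_six _) _ (p6 x.1)
      linarith
  have hv2 : ∀ n, SqBounded (μ n) (ζ n) B (fun i x => fv n i x ^ 2) := fun n =>
    hbase n (fun i => measurable_snd.pow_const 2) fun i x => by
      have h := hle1 _ _ (p6 x.2) (pow_four_le_one_add_pow_six _) _ (p6 x.1)
      simp only [fv, ← pow_mul]
      norm_num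
      linarith
  have hvc : ∀ n, CenteredSqBounded (μ n) (ζ n) B (fv n) := fun n =>
    ⟨hv n, fun i => (hP.mean_V n i).2⟩
  have hmb : ∀ {a : ∀ n, Fin n → ℝ × ℝ → ℝ}, (∀ n, SqBounded (μ n) (ζ n) B (a n)) →
      ∀ n i, |meanOf (μ n) (ζ n) (a n) i| ≤ B := fun ha n i =>
    abs_le_of_sq_le_sq (((ha n).meanOf_sq_le i).trans (by nlinarith)) hB0
  have hVint : ∀ n i, Integrable (fun ω => (M n).V i ω ^ 2) (μ n) := fun n i =>
    ((hv n).memLp i).integrable_sq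
  have me : ∀ n, meanOf (μ n) (ζ n) (fe n) = (M n).sigmaSq (μ n) := fun n => rfl
  have mv : ∀ n, meanOf (μ n) (ζ n) (fun i x => fv n i x ^ 2) = (M n).etaSq (μ n) := fun n => rfl
  have mg : ∀ n, meanOf (μ n) (ζ n) (fg n) = (M n).gam (μ n) := by
    intro n
    funext i
    have h1 : Integrable (fun ω => (M n).e i ω * (M n).V i ω) (μ n) := by
      have hfe : MemLp ((M n).e i) 2 (μ n) := by
        rw [memLp_two_iff_integrable_sq (hP.meas_e n i).aestronglyMeasurable]
        exact ((he n).memLp i).integrable one_le_two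
      exact hfe.integrable_mul ((hv n).memLp i)
    calc _ = ∫ ω, ((M n).Pi i * (M n).e i ω + (M n).e i ω * (M n).V i ω) ∂(μ n) := by
          refine integral_congr_ae (ae_of_all _ fun ω => ?_)
          simp only [fg, ζ]; ring
      _ = _ := by
          rw [integral_add ((hP.mean_e n i).1.const_mul _) h1, integral_const_mul,
            (hP.mean_e n i).2, mul_zero, zero_add]
          rfl
  have mx : ∀ n i, meanOf (μ n) (ζ n) (fx n) i = (M n).Pi i ^ 2 + (M n).etaSq (μ n) i := by
    intro n i
    calc _ = ∫ ω, ((M n).Pi i ^ 2 + 2 * (M n).Pi i * (M n).V i ω + (M n).V i ω ^ 2) ∂(μ n) := by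
          refine integral_congr_ae (ae_of_all _ fun ω => ?_)
          simp only [fx, ζ]; ring
      _ = _ := by
          have h : Integrable (fun ω => (M n).Pi i ^ 2 + 2 * (M n).Pi i * (M n).V i ω) (μ n) :=
            (integrable_const _).add ((hP.mean_V n i).1.const_mul _)
          rw [integral_add h (hVint n i),
            integral_add (integrable_const _) ((hP.mean_V n i).1.const_mul _), integral_const_mul,
            (hP.mean_V n i).2]
          simp [IVModel.etaSq]
  have hform : ∀ {a b : ∀ n, Fin n → ℝ × ℝ → ℝ}, (∀ n, SqBounded (μ n) (ζ n) B (a n)) →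
      (∀ n, SqBounded (μ n) (ζ n) B (b n)) → ∀ {l : ℝ},
      Tendsto (fun n => (M n).form (meanOf (μ n) (ζ n) (a n)) (meanOf (μ n) (ζ n) (b n)))
        atTop (𝓝 l) →
      IsLittleOProb μ fun n ω =>
        (M n).form (fun i => a n i (ζ n i ω)) (fun i => b n i (ζ n i ω)) - l := by
    intro a b ha hb l hl
    have h := (isLittleOProb_bilinear hK hI htr hind hζ hB1 ha hb).add
      (IsLittleOProb.of_tendsto_zero (by simpa using hl.sub_const l))
    convert h using 3 with n ω
    simp only [IVModel.form, IVModel.offSum]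
    ring
  have hjack : ∀ {c : ∀ n, Fin n → ℝ × ℝ → ℝ}, (∀ n, SqBounded (μ n) (ζ n) B (c n)) → ∀ {l : ℝ},
      Tendsto (fun n => (M n).form (meanOf (μ n) (ζ n) (c n)) ((M n).etaSq (μ n))) atTop (𝓝 l) →
      IsLittleOProb μ fun n ω =>
        (M n).jack (fun i => (M n).X i ω) (fun i => c n i (ζ n i ω)) - l := by
    intro c hc l hl
    have h := (isLittleOProb_jackknife hK hI htr hind hζ hB1 hc hvc hv2 hM.Pi_small).add
      (IsLittleOProb.of_tendsto_zero (by simpa using hl.sub_const l))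
    convert h using 3 with n ω
    have e : ∀ x y z : ℝ, x - z = x - y + (y - z) := by intros; ring
    rw [mul_sub]
    exact e _ ((M n).form (meanOf (μ n) (ζ n) (c n)) ((M n).etaSq (μ n))) _
  have jack0 : ∀ {a : ∀ n, Fin n → ℝ × ℝ → ℝ}, (∀ n, SqBounded (μ n) (ζ n) B (a n)) →
      Tendsto (fun n => (M n).jack (M n).Pi (meanOf (μ n) (ζ n) (a n))) atTop (𝓝 0) := fun ha =>
    tendsto_sum_sq_offDiag_mul hK hI htr (hmb ha) hM.Pi_small
  have entry0 : ∀ {a : ∀ n, Fin n → ℝ × ℝ → ℝ}, (∀ n, SqBounded (μ n) (ζ n) B (a n)) →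
      Tendsto (fun n => (M n).form (fun i => (M n).Pi i ^ 2) (meanOf (μ n) (ζ n) (a n)))
        atTop (𝓝 0) := fun ha =>
    tendsto_sum_sq_entry_mul hK hI (hmb ha) hM.Pi_small
  have form_add : ∀ n (x y z : Fin n → ℝ), (M n).form (fun i => y i + z i) x
      = (M n).form y x + (M n).form z x := by
    intro n x y z
    simp only [IVModel.form, IVModel.offSum, Finset.mul_sum, ← Finset.sum_add_distrib]
    exact Finset.sum_congr rfl fun i _ => Finset.sum_congr rfl fun j _ => by ring
  -- E X_i² exceeds η_i² by Π_i², whose contribution vanishes by `entry0`.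
  have mean_fx : ∀ {a : ∀ n, Fin n → ℝ × ℝ → ℝ}, (∀ n, SqBounded (μ n) (ζ n) B (a n)) → ∀ {l : ℝ},
      Tendsto (fun n => (M n).form (meanOf (μ n) (ζ n) (a n)) ((M n).etaSq (μ n))) atTop (𝓝 l) →
      Tendsto (fun n => (M n).form (meanOf (μ n) (ζ n) (a n)) (meanOf (μ n) (ζ n) (fx n)))
        atTop (𝓝 l) := by
    intro a ha l hl
    have h := (entry0 ha).add hl
    rw [zero_add] at h
    refine h.congr fun n => ?_
    rw [(M n).form_symm (hI n) _ ((M n).etaSq (μ n)), ← form_add,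
      (M n).form_symm (hI n) _ (meanOf (μ n) (ζ n) (fx n))]
    congr 1
    funext i
    exact (mx n i).symm
  have lee : Tendsto (fun n => (M n).form ((M n).sigmaSq (μ n)) ((M n).sigmaSq (μ n)))
      atTop (𝓝 (L.Phi1 / 2)) := by
    refine (hL.Phi1.div_const 2).congr fun n => ?_
    rw [IVModel.pop_Phi1]; ring
  have leg : Tendsto (fun n => (M n).form ((M n).sigmaSq (μ n)) ((M n).gam (μ n)))
      atTop (𝓝 (L.Phi12 / 2)) := by
    refine (hL.Phi12.div_const 2).congr fun n => ?_
    rw [IVModel.pop_Phi12 _ _ (hI n)]; ring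
  have lgg : Tendsto (fun n => (M n).form ((M n).gam (μ n)) ((M n).gam (μ n)))
      atTop (𝓝 (L.Phi13 / 2)) := by
    refine (hL.Phi13.div_const 2).congr fun n => ?_
    rw [IVModel.pop_Phi13]; ring
  have lev : Tendsto (fun n => (M n).form ((M n).sigmaSq (μ n)) ((M n).etaSq (μ n)))
      atTop (𝓝 (L.Psi - L.Phi13 / 2)) := by
    have h := (hL.Psi.sub lgg).sub (jack0 he)
    rw [sub_zero] at h
    refine h.congr fun n => ?_
    rw [IVModel.pop_Psi _ _ (hI n), me]; ring
  have lgv : Tendsto (fun n => (M n).form ((M n).gam (μ n)) ((M n).etaSq (μ n)))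
      atTop (𝓝 (L.tau / 2)) := by
    have h := (hL.tau.div_const 2).sub (jack0 hg)
    rw [sub_zero] at h
    refine h.congr fun n => ?_
    rw [IVModel.pop_tau _ _ (hI n), mg]; ring
  have lvv : Tendsto (fun n => (M n).form ((M n).etaSq (μ n)) ((M n).etaSq (μ n)))
      atTop (𝓝 (L.Upsilon / 2)) := by
    have h := (hL.Upsilon.div_const 2).sub ((jack0 hv2).const_mul 2)
    rw [mul_zero, sub_zero] at h
    refine h.congr fun n => ?_
    rw [IVModel.pop_Upsilon, mv]; ring
  have lxv : Tendsto (fun n => (M n).form (meanOf (μ n) (ζ n) (fx n)) ((M n).etaSq (μ n)))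
      atTop (𝓝 (L.Upsilon / 2)) := by
    refine (mean_fx hv2 lvv).congr fun n => ?_
    rw [(M n).form_symm (hI n), mv]
  have lev' : Tendsto (fun n => (M n).form (meanOf (μ n) (ζ n) (fe n)) ((M n).etaSq (μ n)))
      atTop (𝓝 (L.Psi - L.Phi13 / 2)) := lev
  have lgv' : Tendsto (fun n => (M n).form (meanOf (μ n) (ζ n) (fg n)) ((M n).etaSq (μ n)))
      atTop (𝓝 (L.tau / 2)) := by simpa only [mg] using lgv
  exact
    { ee := hform he he lee
      eg := hform he hg (by simpa only [mg, me] using leg)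
      gg := hform hg hg (by simpa only [mg] using lgg)
      ex := hform he hx (mean_fx he lev')
      gx := hform hg hx (mean_fx hg lgv')
      xx := hform hx hx (mean_fx hx lxv)
      je := hjack he lev'
      jg := hjack hg lgv'
      jx := hjack hx lxv }

/-- Each component estimator at `b` is consistent for the corresponding component. -/
structure EstConsistentAt (μ : ∀ n, Measure (Ω n)) (M : ∀ n, IVModel n (K n) (Ω n))
    (L : VarComp) (b : ℝ) : Prop where
  Phi1 : IsLittleOProb μ fun n ω => ((M n).est b ω).Phi1 - (compAt M L b n).Phi1
  Phi12 : IsLittleOProb μ fun n ω => ((M n).est b ω).Phi12 - (compAt M L b n).Phi12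
  Phi13 : IsLittleOProb μ fun n ω => ((M n).est b ω).Phi13 - (compAt M L b n).Phi13
  Psi : IsLittleOProb μ fun n ω => ((M n).est b ω).Psi - (compAt M L b n).Psi
  tau : IsLittleOProb μ fun n ω => ((M n).est b ω).tau - (compAt M L b n).tau
  Upsilon : IsLittleOProb μ fun n ω => ((M n).est b ω).Upsilon - (compAt M L b n).Upsilon

omit [∀ n, IsProbabilityMeasure (μ n)] in
-- The coefficients Δ^m are bounded in n. The limits of the forms recombine to `VarComp.shift`; for
-- instance 4(Ψ - Φ₁₃/2) + 8 Φ₁₃/2 = 4Ψ + 2Φ₁₃ at Δ² in Φ₁.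
theorem FormsConsistent.estConsistentAt (h : FormsConsistent μ M L)
    (hP : ProjectionDesign μ M) (hβ : ∃ C : ℝ, ∀ n, |(M n).beta| ≤ C) (b : ℝ) :
    EstConsistentAt μ M L b := by
  have hI : ∀ n, IsSymmIdem (M n).P := fun n => (M n).isSymmIdem_P (hP.rank_P n)
  obtain ⟨C, hC⟩ := hβ
  have hD : ∀ m : ℕ, ∃ R, ∀ n, |((M n).beta - b) ^ m| ≤ R := fun m => by
    refine ⟨(C + |b|) ^ m, fun n => ?_⟩
    rw [abs_pow]
    exact pow_le_pow_left₀ (abs_nonneg _)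
      ((abs_sub _ _).trans (add_le_add_left (hC n) _)) m
  have hD1 : ∃ R, ∀ n, |(M n).beta - b| ≤ R := by simpa using hD 1
  obtain ⟨ee, eg, gg, ex, gx, xx, je, jg, jx⟩ := h
  constructor
  · convert ((((ee.const_mul 2).add ((eg.const_mul 8).bdd_mul hD1)).add
      (((ex.const_mul 4).add (gg.const_mul 8)).bdd_mul (hD 2))).add
      ((gx.const_mul 8).bdd_mul (hD 3))).add ((xx.const_mul 2).bdd_mul (hD 4)) using 3 with n ω
    rw [(M n).est_Phi1 (hI n)]
    simp only [compAt, VarComp.shift]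
    ring
  · convert (((eg.const_mul 2).add (((gg.const_mul 4).add (ex.const_mul 2)).bdd_mul hD1)).add
      ((gx.const_mul 6).bdd_mul (hD 2))).add ((xx.const_mul 2).bdd_mul (hD 3)) using 3 with n ω
    rw [(M n).est_Phi12 (hI n)]
    simp only [compAt, VarComp.shift]
    ring
  · convert ((gg.const_mul 2).add ((gx.const_mul 4).bdd_mul hD1)).add
      ((xx.const_mul 2).bdd_mul (hD 2)) using 3 with n ω
    rw [(M n).est_Phi13 (hI n)]
    simp only [compAt, VarComp.shift]
    ring
  · convert ((je.add gg).add (((jg.const_mul 2).add (gx.const_mul 2)).bdd_mul hD1)).add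
      ((jx.add xx).bdd_mul (hD 2)) using 3 with n ω
    rw [(M n).est_Psi (hI n)]
    simp only [compAt, VarComp.shift]
    ring
  · convert (jg.add gx).add ((jx.add xx).bdd_mul hD1) using 3 with n ω
    rw [(M n).est_tau (hI n)]
    simp only [compAt, VarComp.shift]
    ring
  · convert xx.const_mul 2 using 3 with n ω
    rw [(M n).est_Upsilon]
    simp only [compAt, VarComp.shift]
    ring

end Consistency

/-! ### The plug-in estimator of `ρ` and positivity of the variances -/

/-- The center t n moves with n, so one δ must serve all centers; compactness provides it. The
values T n may lie outside s. -/
theorem IsLittleOProb.comp_of_isCompact {Ω : ℕ → Type*} [∀ n, MeasurableSpace (Ω n)]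
    {μ : ∀ n, Measure (Ω n)} {E F : Type*} [NormedAddCommGroup E] [NormedAddCommGroup F]
    {T : ∀ n, Ω n → E} {t : ℕ → E} (hT : IsLittleOProb μ fun n ω => T n ω - t n)
    {s : Set E} (hs : IsCompact s) (ht : ∀ᶠ n in atTop, t n ∈ s) {f : E → F}
    (hf : ∀ x ∈ s, ContinuousAt f x) :
    IsLittleOProb μ fun n ω => f (T n ω) - f (t n) := by
  intro ε hε
  obtain ⟨δ, hδ, h⟩ := Metric.mem_uniformity_dist.1
    (hs.uniformContinuousAt_of_continuousAt f hf (Metric.dist_mem_uniformity hε))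
  refine tendsto_of_tendsto_of_tendsto_of_le_of_le' tendsto_const_nhds (hT δ hδ)
    (Eventually.of_forall fun _ => zero_le) ?_
  filter_upwards [ht] with n hn
  refine measure_mono fun ω hω => ?_
  simp only [Set.mem_ofPred_eq] at hω ⊢
  by_contra hcon
  rw [not_le, ← dist_eq_norm, dist_comm] at hcon
  have h1 : dist (f (t n)) (f (T n ω)) < ε := h hcon hn
  rw [dist_comm, dist_eq_norm] at h1
  linarith

namespace VarComp

theorem continuous_shift_Phi1 (L : VarComp) : Continuous fun D => (L.shift D).Phi1 := by
  simp only [shift]; fun_prop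

theorem continuous_shift_Psi (L : VarComp) : Continuous fun D => (L.shift D).Psi := by
  simp only [shift]; fun_prop

theorem continuous_shift_vec (L : VarComp) : Continuous fun D => (L.shift D).vec := by
  refine (PiLp.continuous_toLp 2 _).comp (continuous_pi fun i => ?_)
  fin_cases i <;> simp [shift] <;> fun_prop

/-- A quadratic form in e + ΔX equals Q_ee + 2Δ Q_Xe + Δ² Q_XX, which explains the vector (1, 2Δ,
Δ²); likewise Q_Xe + Δ Q_XX gives (0, 1, Δ) for Ψ. -/
theorem shift_Phi1_eq (L : VarComp) (D : ℝ) :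
    (L.shift D).Phi1 = ![1, 2 * D, D ^ 2] ⬝ᵥ L.cov.mulVec ![1, 2 * D, D ^ 2] := by
  simp [shift, cov, Matrix.mulVec, dotProduct, Fin.sum_univ_three]
  ring

theorem shift_Psi_eq (L : VarComp) (D : ℝ) :
    (L.shift D).Psi = ![0, 1, D] ⬝ᵥ L.cov.mulVec ![0, 1, D] := by
  simp [shift, cov, Matrix.mulVec, dotProduct, Fin.sum_univ_three]
  ring

theorem shift_Phi1_pos {L : VarComp} (hL : L.cov.PosDef) (D : ℝ) : 0 < (L.shift D).Phi1 := by
  rw [shift_Phi1_eq]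
  have h : (![1, 2 * D, D ^ 2] : Fin 3 → ℝ) ≠ 0 := fun h => by simpa using congrFun h 0
  simpa using hL.dotProduct_mulVec_pos h

theorem shift_Psi_pos {L : VarComp} (hL : L.cov.PosDef) (D : ℝ) : 0 < (L.shift D).Psi := by
  rw [shift_Psi_eq]
  have h : (![0, 1, D] : Fin 3 → ℝ) ≠ 0 := fun h => by simpa using congrFun h 1
  simpa using hL.dotProduct_mulVec_pos h

theorem Upsilon_pos {L : VarComp} (hL : L.cov.PosDef) : 0 < L.Upsilon := by
  have h := hL.diag_pos (i := 2)
  simpa [cov] using h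

end VarComp

section Main

variable {K : ℕ → ℕ} {Ω : ℕ → Type*} [∀ n, MeasurableSpace (Ω n)]
  {μ : ∀ n, Measure (Ω n)} {M : ∀ n, IVModel n (K n) (Ω n)} {L : VarComp} {b : ℝ}

theorem EstConsistentAt.vec (h : EstConsistentAt μ M L b) :
    IsLittleOProb μ fun n ω => ((M n).est b ω).vec - (compAt M L b n).vec := by
  refine IsLittleOProb.euclidean fun i => ?_
  fin_cases i
  exacts [h.Phi1, h.Phi12, h.Phi13, h.Psi, h.tau, h.Upsilon]

theorem EstConsistentAt.gamma (h : EstConsistentAt μ M L b)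
    (hβ : ∃ C : ℝ, ∀ n, |(M n).beta| ≤ C)
    (hpos : ∃ c : ℝ, 0 < c ∧ ∀ᶠ n in atTop,
      c ≤ (compAt M L b n).Phi1 ∧ c ≤ (compAt M L b n).Psi) :
    IsLittleOProb μ fun n ω => ((M n).est b ω).gamma - (compAt M L b n).gamma := by
  obtain ⟨C, hC⟩ := hβ
  obtain ⟨c, hc, hev⟩ := hpos
  -- Eventually the centers lie in this compact set: Δ is bounded and both variances are at least c,
  -- so the radicand stays positive.
  have hs : IsCompact ((fun D => (L.shift D).vec) '' (Set.Icc (-(C + |b|)) (C + |b|) ∩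
      ({D | c ≤ (L.shift D).Phi1} ∩ {D | c ≤ (L.shift D).Psi}))) :=
    (isCompact_Icc.inter_right ((isClosed_le continuous_const L.continuous_shift_Phi1).inter
      (isClosed_le continuous_const L.continuous_shift_Psi))).image L.continuous_shift_vec
  have hrho : IsLittleOProb μ fun n ω => ((M n).est b ω).rho - (compAt M L b n).rho := by
    refine h.vec.comp_of_isCompact hs (f := fun v => v 1 / Real.sqrt (v 0 * v 3)) ?_ ?_
    · filter_upwards [hev] with n hn
      exact ⟨(M n).beta - b, ⟨abs_le.1 ((abs_sub _ _).trans (add_le_add_left (hC n) _)), hn⟩, rfl⟩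
    · rintro _ ⟨D, ⟨-, h1, h2⟩, rfl⟩
      have hne : Real.sqrt ((L.shift D).vec 0 * (L.shift D).vec 3) ≠ 0 :=
        (Real.sqrt_pos.2 (mul_pos (hc.trans_le h1) (hc.trans_le h2))).ne'
      refine ContinuousAt.div ?_ ?_ hne <;> fun_prop
  refine IsLittleOProb.euclidean fun i => ?_
  fin_cases i
  exacts [h.Phi1, h.Phi12, h.Phi13, h.Psi, h.tau, h.Upsilon, hrho]

omit [∀ n, MeasurableSpace (Ω n)] in
-- For all n and all b in B, Δ lies in one compact interval, on which a positive continuous function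
-- has a positive minimum.
theorem positiveVariances_of_posDef (hβ : ∃ C : ℝ, ∀ n, |(M n).beta| ≤ C) (hL : L.cov.PosDef)
    {B : Set ℝ} (hB : IsCompact B) : PositiveVariances M L B := by
  obtain ⟨C, hC⟩ := hβ
  obtain ⟨r, hr⟩ := hB.isBounded.exists_norm_le
  have hmem : ∀ n, ∀ b ∈ B, (M n).beta - b ∈ Set.Icc (-(C + r)) (C + r) := fun n b hb =>
    abs_le.1 ((abs_sub _ _).trans (add_le_add (hC n) (hr b hb)))
  have key : ∀ f : ℝ → ℝ, Continuous f → (∀ D, 0 < f D) →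
      ∃ c : ℝ, 0 < c ∧ ∀ n, ∀ b ∈ B, c ≤ f ((M n).beta - b) := by
    intro f hf hpos
    obtain hempty | ⟨b₀, hb₀⟩ := B.eq_empty_or_nonempty
    · exact ⟨1, one_pos, fun n b hb => by simp [hempty] at hb⟩
    obtain ⟨D, -, hD⟩ := isCompact_Icc.exists_isMinOn ⟨_, hmem 0 b₀ hb₀⟩ hf.continuousOn
    exact ⟨f D, hpos D, fun n b hb => hD (hmem n b hb)⟩
  exact ⟨key _ L.continuous_shift_Phi1 (VarComp.shift_Phi1_pos hL),
    key _ L.continuous_shift_Psi (VarComp.shift_Psi_pos hL), VarComp.Upsilon_pos hL⟩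

end Main

end

theorem theorem7 {K : ℕ → ℕ} {Ω : ℕ → Type*} [∀ n, MeasurableSpace (Ω n)]
    (μ : ∀ n, Measure (Ω n)) [∀ n, IsProbabilityMeasure (μ n)]
    (M : ∀ n, IVModel n (K n) (Ω n))
    (hβ : ∃ C : ℝ, ∀ n, |(M n).beta| ≤ C)
    (hP : ProjectionDesign μ M) (hM : MomentConditions μ M)
    (L : VarComp) (hL : IsVarLimit μ M L) :
    (∀ b : ℝ, IsLittleOProb μ fun n ω => ((M n).est b ω).vec - (compAt M L b n).vec) ∧
    (∀ b : ℝ, (∃ c : ℝ, 0 < c ∧ ∀ᶠ n in atTop,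
        c ≤ (compAt M L b n).Phi1 ∧ c ≤ (compAt M L b n).Psi) →
      IsLittleOProb μ fun n ω => ((M n).est b ω).gamma - (compAt M L b n).gamma) ∧
    (∀ B : Set ℝ, IsCompact B → PositiveVariances M L B →
      ConsistentVarianceEstimation μ M L B) ∧
    (L.cov.PosDef → ∀ B : Set ℝ, IsCompact B → ConsistentVarianceEstimation μ M L B) := by
  have hest : ∀ b, EstConsistentAt μ M L b :=
    (formsConsistent hP hM hL).estConsistentAt hP hβ
  have hpos : ∀ B : Set ℝ, PositiveVariances M L B → ConsistentVarianceEstimation μ M L B := by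
    intro B hB
    refine ⟨hB, fun b hb => (hest b).gamma hβ ?_⟩
    obtain ⟨c₁, hc₁, h₁⟩ := hB.Phi1_pos
    obtain ⟨c₂, hc₂, h₂⟩ := hB.Psi_pos
    exact ⟨min c₁ c₂, lt_min hc₁ hc₂, Eventually.of_forall fun n =>
      ⟨(min_le_left _ _).trans (h₁ n b hb), (min_le_right _ _).trans (h₂ n b hb)⟩⟩
  exact ⟨fun b => (hest b).vec, fun b hb => (hest b).gamma hβ hb, fun B _ hB => hpos B hB,
    fun hL' B hB => hpos B (positiveVariances_of_posDef hβ hL' hB)⟩
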